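/- **Setting.** Let $E=(E^0,E^1,r,s)$ be a directed graph with $E^0,E^1$ countable that is row-finite and has no sources, i.e. $vE^1:=r^{-1}(v)$ is finite and non-empty for every $v\in E^0$. Paths are read from right to left: a path of length $n\ge 1$ is a sequence $\alpha=\alpha_1\cdots\alpha_n$ of edges with $s(\alpha_i)=r(\alpha_{i+1})$, with $r(\alpha)=r(\alpha_1)$ and $s(\alpha)=s(\alpha_n)$; vertices are the paths of length $0$. Let $G$ be a countable discrete group, with unit $e_G$, acting on $E$ by graph automorphisms, and let $\varphi\colon G\times E^1\to G$ satisfy $\varphi(gh,e)=\varphi(g,h\cdot e)\varphi(h,e)$ and $\varphi(g,e)\cdot v=g\cdot v$ for all $g,h\in G$, $e\in E^1$, $v\in E^0$. The action and $\varphi$ are extended to the set $E^*$ of finite paths by $\varphi(g,v)=g$ for $v\in E^0$, $g\cdot(e\beta)=(g\cdot e)(\varphi(g,e)\cdot\beta)$ and $\varphi(g,e\beta)=\varphi(\varphi(g,e),\beta)$. Let $R$ be a unital commutative $*$-ring. The Exel–Pardo $*$-algebra $L_R(G,E)$ is the universal $*$-algebra over $R$ (not necessarily unital) generated by elements $p_{v,f}$,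 $s_{e,g}$ ($v\in E^0$, $e\in E^1$, $f,g\in G$) subject to the following relations. * The $p_{v,e_G}$ are mutually orthogonal projections and the $s_{e,e_G}$ are partial isometries such that $s_{e,e_G}^*s_{f,e_G}=\delta_{e,f}\,p_{s(e),e_G}$ and $p_{v,e_G}=\sum_{e\in vE^1}s_{e,e_G}s_{e,e_G}^*$. * $p_{v,f}^*=p_{f^{-1}\cdot v,\,f^{-1}}$ and $p_{v,f}\,p_{w,h}=\delta_{v,f\cdot w}\,p_{v,fh}$. * $p_{v,f}\,s_{e,g}=\delta_{v,r(f\cdot e)}\,s_{f\cdot e,\,\varphi(f,e)g}$ and $s_{e,g}\,p_{v,f}=\delta_{g\cdot v,s(e)}\,s_{e,gf}$. A path $\alpha\in E^*$ is *strongly fixed* by $g\in G$ if $g\cdot\alpha=\alpha$ and $\varphi(g,\alpha)=e_G$; it is a *minimal strongly fixed path for $g$* if moreover no proper initial segment of $\alpha$ is strongly fixed by $g$. A *$G$-circuit* in $E$ is a pair $(g,\gamma)$ with $g\in G$ and $\gamma\in E^*$ of nonzero length such that $s(\gamma)=g\cdot r(\gamma)$. Idempotents $e,f$ of a ring $B$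 are equivalent if there are $x\in eBf$, $y\in fBe$ with $xy=e$ and $yx=f$. An idempotent $e$ is *infinite* if $e=f+h$ with orthogonal idempotents $f,h$ such that $f$ is equivalent to $e$ and $h\neq 0$. A (not necessarily unital) simple ring is *purely infinite* if each of its nonzero right ideals contains an infinite idempotent. **Proposition.** Suppose that for every $g\in G$ and every $v\in E^0$ there are at most finitely many minimal strongly fixed paths for $g$ with range $v$, and that $L_R(G,E)$ is simple. If $E$ contains at least one $G$-circuit, then $L_R(G,E)$ is purely infinite simple. -/

import Mathlib

/-! ### Row-finite directed graphs without sources, and paths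

Paths read from right to left: in a path `e₁ e₂ ⋯ eₙ` one has `s (eᵢ) = r (eᵢ₊₁)`. -/

/-- A row-finite directed graph with no sources, with vertex set `V` and edge set `Ed`. -/
structure RowFiniteGraph (V Ed : Type*) where
  r : Ed → V
  s : Ed → V
  row_finite : ∀ v, (r ⁻¹' {v}).Finite
  no_sources : ∀ v, (r ⁻¹' {v}).Nonempty

namespace RowFiniteGraph

/-- The finite set `v E¹` of edges with range `v`. -/
noncomputable def edgesTo {V Ed : Type*} (E : RowFiniteGraph V Ed) (v : V) : Finset Ed :=
  (E.row_finite v).toFinset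

/-- The list of edges `l` is a path with range `v` (the empty list being the vertex `v`). -/
def IsPathTo {V Ed : Type*} (E : RowFiniteGraph V Ed) : V → List Ed → Prop
  | _, [] => True
  | v, e :: l => E.r e = v ∧ E.IsPathTo (E.s e) l

/-- The source of the path with range `v` and list of edges `l`. -/
def sourceOf {V Ed : Type*} (E : RowFiniteGraph V Ed) : V → List Ed → V
  | v, [] => v
  | _, e :: l => E.sourceOf (E.s e) l

/-- Finite paths in `E`; the paths of length `0` are the vertices. -/
@[ext]
structure Path {V Ed : Type*} (E : RowFiniteGraph V Ed) where
  range : V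
  edges : List Ed
  isPath : E.IsPathTo range edges

namespace Path

def source {V Ed : Type*} {E : RowFiniteGraph V Ed} (α : E.Path) : V :=
  E.sourceOf α.range α.edges

def length {V Ed : Type*} {E : RowFiniteGraph V Ed} (α : E.Path) : ℕ :=
  α.edges.length

/-- `β` is an initial segment of `α` (possibly the vertex `r(α)`, possibly `α` itself). -/
def IsPrefix {V Ed : Type*} {E : RowFiniteGraph V Ed} (β α : E.Path) : Prop :=
  β.range = α.range ∧ β.edges <+: α.edges

end Path

end RowFiniteGraph

/-! ### Self-similar actions -/

/-- An action of a group `G` by automorphisms on the graph `E` (given by actions on vertices and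
on edges that commute with range and source) with a one-cocycle `φ : G × E¹ → G` such that
`φ(g, e) • v = g • v` for every vertex `v`. -/
structure SelfSimilarAction (G : Type*) {V Ed : Type*} [Group G] [MulAction G V] [MulAction G Ed]
    (E : RowFiniteGraph V Ed) where
  range_smul : ∀ (g : G) (e : Ed), E.r (g • e) = g • E.r e
  source_smul : ∀ (g : G) (e : Ed), E.s (g • e) = g • E.s e
  φ : G → Ed → G
  cocycle : ∀ (g h : G) (e : Ed), φ (g * h) e = φ g (h • e) * φ h e
  φ_smul : ∀ (g : G) (e : Ed) (v : V), φ g e • v = g • v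

namespace SelfSimilarAction

/-- The action on lists of edges: `g • (e β) = (g • e) (φ(g, e) • β)`. -/
def actList {G V Ed : Type*} [Group G] [MulAction G V] [MulAction G Ed] {E : RowFiniteGraph V Ed}
    (A : SelfSimilarAction G E) : G → List Ed → List Ed
  | _, [] => []
  | g, e :: l => (g • e) :: A.actList (A.φ g e) l

/-- The cocycle on lists of edges: `φ(g, v) = g` for a vertex `v`, and
`φ(g, e β) = φ(φ(g, e), β)`. -/
def cocycleList {G V Ed : Type*} [Group G] [MulAction G V] [MulAction G Ed]
    {E : RowFiniteGraph V Ed} (A : SelfSimilarAction G E) : G → List Ed → G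
  | g, [] => g
  | g, e :: l => A.cocycleList (A.φ g e) l

theorem isPathTo_actList {G V Ed : Type*} [Group G] [MulAction G V] [MulAction G Ed]
    {E : RowFiniteGraph V Ed} (A : SelfSimilarAction G E) (l : List Ed) :
    ∀ (g : G) (v : V), E.IsPathTo v l → E.IsPathTo (g • v) (A.actList g l) := by
  induction l with
  | nil => intro g v _; trivial
  | cons e l ih =>
    rintro g v ⟨h1, h2⟩
    refine ⟨by rw [A.range_smul, h1], ?_⟩
    have := ih (A.φ g e) (E.s e) h2
    rwa [A.φ_smul, ← A.source_smul] at this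

/-- The action of `G` on finite paths. -/
def actPath {G V Ed : Type*} [Group G] [MulAction G V] [MulAction G Ed] {E : RowFiniteGraph V Ed}
    (A : SelfSimilarAction G E) (g : G) (α : E.Path) : E.Path where
  range := g • α.range
  edges := A.actList g α.edges
  isPath := A.isPathTo_actList α.edges g α.range α.isPath

/-- The cocycle on finite paths. -/
def cocyclePath {G V Ed : Type*} [Group G] [MulAction G V] [MulAction G Ed]
    {E : RowFiniteGraph V Ed} (A : SelfSimilarAction G E) (g : G) (α : E.Path) : G :=
  A.cocycleList g α.edges

/-- `α` is strongly fixed by `g`: `g • α = α` and `φ(g, α) = 1`. -/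
def StronglyFixed {G V Ed : Type*} [Group G] [MulAction G V] [MulAction G Ed]
    {E : RowFiniteGraph V Ed} (A : SelfSimilarAction G E) (g : G) (α : E.Path) : Prop :=
  A.actPath g α = α ∧ A.cocyclePath g α = 1

/-- `α` is a minimal strongly fixed path for `g`: it is strongly fixed by `g` and no proper
initial segment of `α` is. -/
def MinimalStronglyFixed {G V Ed : Type*} [Group G] [MulAction G V] [MulAction G Ed]
    {E : RowFiniteGraph V Ed} (A : SelfSimilarAction G E) (g : G) (α : E.Path) : Prop :=
  A.StronglyFixed g α ∧ ∀ β : E.Path, β.IsPrefix α → A.StronglyFixed g β → β = α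

/-- `(g, γ)` is a `G`-circuit: `γ` is a path of nonzero length with `s(γ) = g • r(γ)`. -/
def IsGCircuit {G V Ed : Type*} [Group G] [MulAction G V] [MulAction G Ed]
    {E : RowFiniteGraph V Ed} (_A : SelfSimilarAction G E) (g : G) (γ : E.Path) : Prop :=
  γ.length ≠ 0 ∧ γ.source = g • γ.range

end SelfSimilarAction

/-! ### Families -/

/-- An `E`-family in a `*`-algebra. -/
structure IsEFamily {V Ed B : Type*} [NonUnitalRing B] [StarRing B] (E : RowFiniteGraph V Ed)
    (P : V → B) (S : Ed → B) : Prop where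
  star_P : ∀ v, star (P v) = P v
  P_mul_self : ∀ v, P v * P v = P v
  P_mul_P : ∀ v w, v ≠ w → P v * P w = 0
  partial_isometry : ∀ e, S e * star (S e) * S e = S e
  star_S_mul_self : ∀ e, star (S e) * S e = P (E.s e)
  star_S_mul : ∀ e f, e ≠ f → star (S e) * S f = 0
  sum_range : ∀ v, P v = ∑ e ∈ E.edgesTo v, S e * star (S e)

open Classical in
/-- A `(G, E)`-family in a `*`-algebra. -/
structure IsGEFamily {G V Ed B : Type*} [Group G] [MulAction G V] [MulAction G Ed]
    [NonUnitalRing B] [StarRing B] {E : RowFiniteGraph V Ed} (A : SelfSimilarAction G E)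
    (P : V → G → B) (S : Ed → G → B) : Prop where
  eFamily : IsEFamily E (fun v => P v 1) (fun e => S e 1)
  star_P : ∀ v f, star (P v f) = P (f⁻¹ • v) f⁻¹
  P_mul_P : ∀ v w f h, P v f * P w h = if v = f • w then P v (f * h) else 0
  P_mul_S : ∀ v e f g,
    P v f * S e g = if v = E.r (f • e) then S (f • e) (A.φ f e * g) else 0
  S_mul_P : ∀ v e f g, S e g * P v f = if g • v = E.s e then S e (g * f) else 0

/-! ### The Exel--Pardo `*`-algebra

It is the `*`-algebra over `R` presented by generators `p_{v,f}`, `s_{e,g}` and the relations of a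
`(G, E)`-family: formal `*`-algebra expressions in the generators, modulo the congruence generated
by the axioms of `*`-algebras over `R` and these relations. -/

namespace ExelPardo

/-- Formal expressions in the generators. -/
inductive Pre (R G V Ed : Type*)
  | p (v : V) (f : G)
  | s (e : Ed) (g : G)
  | zero
  | add (a b : Pre R G V Ed)
  | neg (a : Pre R G V Ed)
  | smul (r : R) (a : Pre R G V Ed)
  | mul (a b : Pre R G V Ed)
  | star (a : Pre R G V Ed)

namespace Pre

/-- Formal sum of a list of expressions. -/
def listSum {R G V Ed : Type*} (l : List (Pre R G V Ed)) : Pre R G V Ed :=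
  l.foldr add zero

end Pre

open Pre in
open Classical in
/-- The relations. -/
inductive Rel (R : Type*) [CommRing R] [StarRing R] {G V Ed : Type*} [Group G]
    [MulAction G V] [MulAction G Ed] {E : RowFiniteGraph V Ed} (A : SelfSimilarAction G E) :
    Pre R G V Ed → Pre R G V Ed → Prop
  -- compatibility with the operations
  | add_left {a b c} : Rel R A a b → Rel R A (add a c) (add b c)
  | add_right {a b c} : Rel R A a b → Rel R A (add c a) (add c b)
  | neg_congr {a b} : Rel R A a b → Rel R A (neg a) (neg b)
  | smul_congr {r a b} : Rel R A a b → Rel R A (smul r a) (smul r b)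
  | mul_left {a b c} : Rel R A a b → Rel R A (mul a c) (mul b c)
  | mul_right {a b c} : Rel R A a b → Rel R A (mul c a) (mul c b)
  | star_congr {a b} : Rel R A a b → Rel R A (star a) (star b)
  -- the axioms of associative algebras over `R`
  | add_assoc {a b c} : Rel R A (add (add a b) c) (add a (add b c))
  | add_comm {a b} : Rel R A (add a b) (add b a)
  | zero_add {a} : Rel R A (add zero a) a
  | neg_add {a} : Rel R A (add (neg a) a) zero
  | mul_assoc {a b c} : Rel R A (mul (mul a b) c) (mul a (mul b c))
  | mul_add {a b c} : Rel R A (mul a (add b c)) (add (mul a b) (mul a c))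
  | add_mul {a b c} : Rel R A (mul (add a b) c) (add (mul a c) (mul b c))
  | one_smul {a} : Rel R A (smul 1 a) a
  | mul_smul {r t a} : Rel R A (smul (r * t) a) (smul r (smul t a))
  | smul_add {r a b} : Rel R A (smul r (add a b)) (add (smul r a) (smul r b))
  | add_smul {r t a} : Rel R A (smul (r + t) a) (add (smul r a) (smul t a))
  | smul_mul {r a b} : Rel R A (mul (smul r a) b) (smul r (mul a b))
  | mul_smul_comm {r a b} : Rel R A (mul a (smul r b)) (smul r (mul a b))
  -- the axioms of an involution
  | star_star {a} : Rel R A (star (star a)) a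
  | star_mul {a b} : Rel R A (star (mul a b)) (mul (star b) (star a))
  | star_add {a b} : Rel R A (star (add a b)) (add (star a) (star b))
  | star_smul {r a} : Rel R A (star (smul r a)) (smul (Star.star r) (star a))
  -- the relations of an `E`-family
  | star_p_one (v) : Rel R A (star (p v 1)) (p v 1)
  | p_mul_self (v) : Rel R A (mul (p v 1) (p v 1)) (p v 1)
  | p_mul_p_ne (v w) : v ≠ w → Rel R A (mul (p v 1) (p w 1)) zero
  | partial_isometry (e) : Rel R A (mul (mul (s e 1) (star (s e 1))) (s e 1)) (s e 1)
  | star_s_mul_self (e) : Rel R A (mul (star (s e 1)) (s e 1)) (p (E.s e) 1)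
  | star_s_mul_ne (e f) : e ≠ f → Rel R A (mul (star (s e 1)) (s f 1)) zero
  | sum_range (v) :
      Rel R A (p v 1)
        (listSum ((E.edgesTo v).toList.map fun e => mul (s e 1) (star (s e 1))))
  -- the further relations of a `(G, E)`-family
  | star_p (v f) : Rel R A (star (p v f)) (p (f⁻¹ • v) f⁻¹)
  | p_mul_p (v w f h) :
      Rel R A (mul (p v f) (p w h)) (if v = f • w then p v (f * h) else zero)
  | p_mul_s (v e f g) :
      Rel R A (mul (p v f) (s e g))
        (if v = E.r (f • e) then s (f • e) (A.φ f e * g) else zero)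
  | s_mul_p (v e f g) :
      Rel R A (mul (s e g) (p v f)) (if g • v = E.s e then s e (g * f) else zero)

end ExelPardo

/-- The Exel--Pardo `*`-algebra `L_R(G, E)`. -/
def ExelPardoAlgebra (R : Type*) [CommRing R] [StarRing R] {G V Ed : Type*} [Group G]
    [MulAction G V] [MulAction G Ed] {E : RowFiniteGraph V Ed} (A : SelfSimilarAction G E) :
    Type _ :=
  Quot (ExelPardo.Rel R A)

namespace ExelPardoAlgebra

variable {R : Type*} [CommRing R] [StarRing R] {G V Ed : Type*} [Group G]
  [MulAction G V] [MulAction G Ed] {E : RowFiniteGraph V Ed} {A : SelfSimilarAction G E}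

instance : Zero (ExelPardoAlgebra R A) := ⟨Quot.mk _ .zero⟩

instance : Add (ExelPardoAlgebra R A) :=
  ⟨Quot.map₂ .add (fun _ _ _ h => .add_right h) (fun _ _ _ h => .add_left h)⟩

instance : Neg (ExelPardoAlgebra R A) := ⟨Quot.map .neg fun _ _ h => .neg_congr h⟩

instance : Mul (ExelPardoAlgebra R A) :=
  ⟨Quot.map₂ .mul (fun _ _ _ h => .mul_right h) (fun _ _ _ h => .mul_left h)⟩

instance : SMul R (ExelPardoAlgebra R A) :=
  ⟨fun r => Quot.map (.smul r) fun _ _ h => .smul_congr h⟩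

instance : Star (ExelPardoAlgebra R A) := ⟨Quot.map .star fun _ _ h => .star_congr h⟩

instance : AddCommGroup (ExelPardoAlgebra R A) where
  add_assoc := by rintro ⟨a⟩ ⟨b⟩ ⟨c⟩; exact Quot.sound .add_assoc
  zero_add := by rintro ⟨a⟩; exact Quot.sound .zero_add
  add_zero := by rintro ⟨a⟩; exact (Quot.sound .add_comm).trans (Quot.sound .zero_add)
  neg_add_cancel := by rintro ⟨a⟩; exact Quot.sound .neg_add
  add_comm := by rintro ⟨a⟩ ⟨b⟩; exact Quot.sound .add_comm
  nsmul := nsmulRec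
  zsmul := zsmulRec

theorem mul_add' (a b c : ExelPardoAlgebra R A) : a * (b + c) = a * b + a * c := by
  obtain ⟨a⟩ := a; obtain ⟨b⟩ := b; obtain ⟨c⟩ := c; exact Quot.sound .mul_add

theorem add_mul' (a b c : ExelPardoAlgebra R A) : (a + b) * c = a * c + b * c := by
  obtain ⟨a⟩ := a; obtain ⟨b⟩ := b; obtain ⟨c⟩ := c; exact Quot.sound .add_mul

instance : NonUnitalRing (ExelPardoAlgebra R A) where
  left_distrib := mul_add'
  right_distrib := add_mul'
  zero_mul a := by
    have h := add_mul' 0 0 a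
    rw [add_zero] at h
    exact (left_eq_add.mp h)
  mul_zero a := by
    have h := mul_add' a 0 0
    rw [add_zero] at h
    exact (left_eq_add.mp h)
  mul_assoc := by rintro ⟨a⟩ ⟨b⟩ ⟨c⟩; exact Quot.sound .mul_assoc

theorem add_smul' (r t : R) (a : ExelPardoAlgebra R A) : (r + t) • a = r • a + t • a := by
  obtain ⟨a⟩ := a; exact Quot.sound .add_smul

theorem smul_add' (r : R) (a b : ExelPardoAlgebra R A) : r • (a + b) = r • a + r • b := by
  obtain ⟨a⟩ := a; obtain ⟨b⟩ := b; exact Quot.sound .smul_add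

instance : Module R (ExelPardoAlgebra R A) where
  one_smul := by rintro ⟨a⟩; exact Quot.sound .one_smul
  mul_smul := by rintro r t ⟨a⟩; exact Quot.sound .mul_smul
  smul_add := smul_add'
  add_smul := add_smul'
  smul_zero r := by
    have h := smul_add' r (0 : ExelPardoAlgebra R A) 0
    rw [add_zero] at h
    exact (left_eq_add.mp h)
  zero_smul a := by
    have h := add_smul' (0 : R) 0 a
    rw [add_zero] at h
    exact (left_eq_add.mp h)

instance : IsScalarTower R (ExelPardoAlgebra R A) (ExelPardoAlgebra R A) where
  smul_assoc := by rintro r ⟨a⟩ ⟨b⟩; exact Quot.sound .smul_mul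

instance : SMulCommClass R (ExelPardoAlgebra R A) (ExelPardoAlgebra R A) where
  smul_comm := by rintro r ⟨a⟩ ⟨b⟩; exact (Quot.sound .mul_smul_comm).symm

instance : StarRing (ExelPardoAlgebra R A) where
  star_involutive := by rintro ⟨a⟩; exact Quot.sound .star_star
  star_mul := by rintro ⟨a⟩ ⟨b⟩; exact Quot.sound .star_mul
  star_add := by rintro ⟨a⟩ ⟨b⟩; exact Quot.sound .star_add

instance : StarModule R (ExelPardoAlgebra R A) where
  star_smul := by rintro r ⟨a⟩; exact Quot.sound .star_smul

/-- The generators `p_{v,f}`. -/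
def p (R : Type*) [CommRing R] [StarRing R] {G V Ed : Type*} [Group G]
    [MulAction G V] [MulAction G Ed] {E : RowFiniteGraph V Ed} (A : SelfSimilarAction G E)
    (v : V) (f : G) : ExelPardoAlgebra R A :=
  Quot.mk _ (.p v f)

/-- The generators `s_{e,g}`. -/
def s (R : Type*) [CommRing R] [StarRing R] {G V Ed : Type*} [Group G]
    [MulAction G V] [MulAction G Ed] {E : RowFiniteGraph V Ed} (A : SelfSimilarAction G E)
    (e : Ed) (g : G) : ExelPardoAlgebra R A :=
  Quot.mk _ (.s e g)

/-- The class of a formal expression. -/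
def mk (R : Type*) [CommRing R] [StarRing R] {G V Ed : Type*} [Group G]
    [MulAction G V] [MulAction G Ed] {E : RowFiniteGraph V Ed} (A : SelfSimilarAction G E)
    (a : ExelPardo.Pre R G V Ed) : ExelPardoAlgebra R A :=
  Quot.mk _ a

theorem mk_listSum (l : List (ExelPardo.Pre R G V Ed)) :
    mk R A (ExelPardo.Pre.listSum l) = (l.map (mk R A)).sum := by
  induction l with
  | nil => rfl
  | cons a l ih => rw [List.map_cons, List.sum_cons, ← ih]; rfl

/-- The generators form a `(G, E)`-family. -/
theorem isGEFamily (R : Type*) [CommRing R] [StarRing R] {G V Ed : Type*} [Group G]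
    [MulAction G V] [MulAction G Ed] {E : RowFiniteGraph V Ed} (A : SelfSimilarAction G E) :
    IsGEFamily A (p R A) (s R A) where
  eFamily :=
    { star_P := fun v => Quot.sound (.star_p_one v)
      P_mul_self := fun v => Quot.sound (.p_mul_self v)
      P_mul_P := fun v w h => Quot.sound (.p_mul_p_ne v w h)
      partial_isometry := fun e => Quot.sound (.partial_isometry e)
      star_S_mul_self := fun e => Quot.sound (.star_s_mul_self e)
      star_S_mul := fun e f h => Quot.sound (.star_s_mul_ne e f h)
      sum_range := fun v => by
        refine (Quot.sound (.sum_range v)).trans ?_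
        change mk R A _ = _
        rw [mk_listSum, List.map_map, ← Finset.sum_map_toList]
        rfl }
  star_P v f := Quot.sound (.star_p v f)
  P_mul_P v w f h := by
    refine (Quot.sound (.p_mul_p v w f h)).trans ?_
    split_ifs <;> rfl
  P_mul_S v e f g := by
    refine (Quot.sound (.p_mul_s v e f g)).trans ?_
    split_ifs <;> rfl
  S_mul_P v e f g := by
    refine (Quot.sound (.s_mul_p v e f g)).trans ?_
    split_ifs <;> rfl

/-- Evaluation of formal expressions. -/
def evalPre {R G V Ed B : Type*} [CommRing R] [NonUnitalRing B]
    [Module R B] [StarRing B] (P : V → G → B) (S : Ed → G → B) : ExelPardo.Pre R G V Ed → B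
  | .p v f => P v f
  | .s e g => S e g
  | .zero => 0
  | .add a b => evalPre P S a + evalPre P S b
  | .neg a => -evalPre P S a
  | .smul r a => r • evalPre P S a
  | .mul a b => evalPre P S a * evalPre P S b
  | .star a => star (evalPre P S a)

theorem evalPre_listSum {R G V Ed B : Type*} [CommRing R] [NonUnitalRing B]
    [Module R B] [StarRing B] (P : V → G → B) (S : Ed → G → B) (l : List (ExelPardo.Pre R G V Ed)) :
    evalPre P S (ExelPardo.Pre.listSum l) = (l.map (evalPre P S)).sum := by
  induction l with
  | nil => rfl
  | cons a l ih => rw [List.map_cons, List.sum_cons, ← ih]; rfl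

theorem evalPre_rel {B : Type*} [NonUnitalRing B] [Module R B] [StarRing B]
    [IsScalarTower R B B] [SMulCommClass R B B] [StarModule R B]
    {P : V → G → B} {S : Ed → G → B} (h : IsGEFamily A P S) {a b : ExelPardo.Pre R G V Ed}
    (hab : ExelPardo.Rel R A a b) : evalPre P S a = evalPre P S b := by
  induction hab with
  | add_left _ ih | add_right _ ih | neg_congr _ ih | smul_congr _ ih | mul_left _ ih
  | mul_right _ ih | star_congr _ ih => simp only [evalPre, ih]
  | add_assoc => exact _root_.add_assoc _ _ _
  | add_comm => exact _root_.add_comm _ _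
  | zero_add => exact _root_.zero_add _
  | neg_add => exact neg_add_cancel _
  | mul_assoc => exact _root_.mul_assoc _ _ _
  | mul_add => exact _root_.mul_add _ _ _
  | add_mul => exact _root_.add_mul _ _ _
  | one_smul => exact _root_.one_smul _ _
  | mul_smul => exact mul_smul _ _ _
  | smul_add => exact _root_.smul_add _ _ _
  | add_smul => exact _root_.add_smul _ _ _
  | smul_mul => exact smul_mul_assoc _ _ _
  | mul_smul_comm => exact _root_.mul_smul_comm _ _ _
  | star_star => exact _root_.star_star _
  | star_mul => exact star_mul _ _
  | star_add => exact star_add _ _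
  | star_smul => exact star_smul _ _
  | star_p_one v => exact h.eFamily.star_P v
  | p_mul_self v => exact h.eFamily.P_mul_self v
  | p_mul_p_ne v w hvw => exact h.eFamily.P_mul_P v w hvw
  | partial_isometry e => exact h.eFamily.partial_isometry e
  | star_s_mul_self e => exact h.eFamily.star_S_mul_self e
  | star_s_mul_ne e f hef => exact h.eFamily.star_S_mul e f hef
  | sum_range v =>
    refine (h.eFamily.sum_range v).trans ?_
    rw [evalPre_listSum, List.map_map, ← Finset.sum_map_toList]
    rfl
  | star_p v f => exact h.star_P v f
  | p_mul_p v w f g => refine (h.P_mul_P v w f g).trans ?_; split_ifs <;> rfl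
  | p_mul_s v e f g => refine (h.P_mul_S v e f g).trans ?_; split_ifs <;> rfl
  | s_mul_p v e f g => refine (h.S_mul_P v e f g).trans ?_; split_ifs <;> rfl

/-- The universal property: every `(G, E)`-family in a `*`-algebra `B` over `R` is the image of
the family of generators under a unique `*`-homomorphism. -/
theorem existsUnique_lift {B : Type*} [NonUnitalRing B] [Module R B] [StarRing B]
    [IsScalarTower R B B] [SMulCommClass R B B] [StarModule R B]
    {P : V → G → B} {S : Ed → G → B} (h : IsGEFamily A P S) :
    ∃! π : ExelPardoAlgebra R A →⋆ₙₐ[R] B,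
      (∀ v f, π (p R A v f) = P v f) ∧ ∀ e g, π (s R A e g) = S e g := by
  refine ⟨{ toFun := Quot.lift (evalPre P S) fun _ _ hab => evalPre_rel h hab
            map_smul' := by rintro r ⟨a⟩; rfl
            map_zero' := rfl
            map_add' := by rintro ⟨a⟩ ⟨b⟩; rfl
            map_mul' := by rintro ⟨a⟩ ⟨b⟩; rfl
            map_star' := by rintro ⟨a⟩; rfl }, ⟨fun _ _ => rfl, fun _ _ => rfl⟩, ?_⟩
  rintro π ⟨hp, hs⟩
  ext ⟨a⟩
  change π (Quot.mk _ a) = evalPre P S a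
  induction a with
  | p v f => exact hp v f
  | s e g => exact hs e g
  | zero => exact map_zero π
  | add a b iha ihb => exact (map_add π _ _).trans (congrArg₂ _ iha ihb)
  | neg a ih => exact (map_neg π _).trans (congrArg _ ih)
  | smul r a ih => exact (map_smul π r _).trans (congrArg _ ih)
  | mul a b iha ihb => exact (map_mul π _ _).trans (congrArg₂ _ iha ihb)
  | star a ih => exact (map_star π _).trans (congrArg _ ih)

end ExelPardoAlgebra

/-! ### Purely infinite simple rings -/

/-- Idempotents `e`, `f` of a ring are equivalent: `e = x y` and `f = y x` for some
`x ∈ e B f` and `y ∈ f B e`. -/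
def IdempotentEquiv {B : Type*} [NonUnitalRing B] (e f : B) : Prop :=
  ∃ x y : B, e * x * f = x ∧ f * y * e = y ∧ x * y = e ∧ y * x = f

/-- `e` is an infinite idempotent: `e = f + g` with orthogonal idempotents `f`, `g` such that
`f` is equivalent to `e` and `g ≠ 0`. -/
def IsInfiniteIdempotent {B : Type*} [NonUnitalRing B] (e : B) : Prop :=
  IsIdempotentElem e ∧ ∃ f g : B, IsIdempotentElem f ∧ IsIdempotentElem g ∧
    f * g = 0 ∧ g * f = 0 ∧ e = f + g ∧ IdempotentEquiv e f ∧ g ≠ 0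

/-- A ring (possibly without unit) is purely infinite simple if it is simple and every nonzero
right ideal contains an infinite idempotent. -/
def IsPurelyInfiniteSimple (B : Type*) [NonUnitalRing B] : Prop :=
  IsSimpleRing B ∧
    ∀ I : AddSubgroup B, (∀ x ∈ I, ∀ b : B, x * b ∈ I) → I ≠ ⊥ →
      ∃ e ∈ I, IsInfiniteIdempotent e

/-! The algebra acts on the free module on a set of infinite paths: `p_{v,f}` and `s_{e,g}` act by
the partial bijections x ↦ f·x and x ↦ e(g·x), and their adjoints by the inverse maps. By simplicity
every such action on a non-empty set is faithful (`rep_injective`), so identities between elements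
can be tested on points. Three point sets matter: all infinite paths, which are used for most
computations; infinite paths confined to a suitable set of vertices, which give cofinality; and
infinite paths with a germ in G and a degree. An identity proved on plain paths holds in the
algebra, and can then be read on the third set, where it says something about cocycles and lengths
that plain paths do not see.

Let a ≠ 0. After right multiplication by the monomial of a long word, a acts near some path x as a
finite sum of weighted maps z ↦ l(g·z) (`exists_local_form`). Collect the maps that agree near x.
Two maps that remain still disagree on every cylinder sufficiently close to x
(`exists_forall_cyl_ne`). For words of different lengths this holds because such maps coincide in at
most one point. For equal lengths, agreement on a cylinder means that a group element h fixes it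
pointwise; the germs show that the cocycle of h becomes trivial there, and finiteness of the minimal
strongly fixed paths bounds the stage at which this happens, so that h would also fix everything
near x. Hence on some smaller cylinder all these maps have pairwise disjoint images, and compressing
to one of them turns a into c·p_w ≠ 0. As c times the algebra is a nonzero ideal, c can be
cancelled, and b a d = p_w for some b, d (`exists_mul_mul_eq_p`).

An infinite path obtained by unrolling the circuit and cofinality lead from w to the orbit of the
base vertex u of the circuit, so p_w can in turn be compressed to p_u. The monomial z of the circuit
satisfies z*z = p_u and zz* ≤ p_u. If zz* = p_u, there would be only one infinite path with range u,
forcing z = p_u, which the degree excludes. So p_u is infinite, and the factorization of p_u through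
a moves this infinite idempotent into the right ideal generated by a. -/

/-! ### The doubled algebra

A `*`-algebra in which the second factor records adjoints. -/

/-- The product of an algebra with its opposite, with the exchange involution. -/
def Doubled (B : Type*) : Type _ := B × Bᵐᵒᵖ

namespace Doubled

variable {R B : Type*}

/-- The element with components `a` and `b`. -/
def mk (a b : B) : Doubled B := (a, MulOpposite.op b)

/-- The first component. -/
def fst (x : Doubled B) : B := Prod.fst x

/-- The second component. -/
def snd (x : Doubled B) : B := MulOpposite.unop (Prod.snd x)

@[ext]
theorem ext {x y : Doubled B} (h : x.fst = y.fst) (h' : x.snd = y.snd) : x = y :=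
  Prod.ext h (MulOpposite.unop_injective h')

@[simp] theorem fst_mk (a b : B) : (mk a b).fst = a := rfl
@[simp] theorem snd_mk (a b : B) : (mk a b).snd = b := rfl
variable [CommRing R] [StarRing R] [Ring B] [Algebra R B]

instance : Ring (Doubled B) := inferInstanceAs (Ring (B × Bᵐᵒᵖ))

@[simp] theorem fst_mul (x y : Doubled B) : (x * y).fst = x.fst * y.fst := rfl
@[simp] theorem snd_mul (x y : Doubled B) : (x * y).snd = y.snd * x.snd := rfl
@[simp] theorem fst_add (x y : Doubled B) : (x + y).fst = x.fst + y.fst := rfl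
@[simp] theorem fst_zero : (0 : Doubled B).fst = 0 := rfl
@[simp] theorem snd_zero : (0 : Doubled B).snd = 0 := rfl

instance : StarRing (Doubled B) where
  star x := mk x.snd x.fst
  star_involutive _ := rfl
  star_mul _ _ := rfl
  star_add _ _ := rfl

@[simp] theorem fst_star (x : Doubled B) : (star x).fst = x.snd := rfl
@[simp] theorem snd_star (x : Doubled B) : (star x).snd = x.fst := rfl

/-- Scalars act on the second component through their conjugate; this makes the exchange involution
conjugate-linear over `R`. -/
instance : Module R (Doubled B) where
  smul r x := mk (r • x.fst) (star r • x.snd)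
  one_smul x := ext (one_smul _ _) (by change star (1 : R) • _ = _; simp)
  mul_smul r t x := ext (mul_smul _ _ _) (by
    change star (r * t) • x.snd = star r • star t • x.snd
    rw [star_mul', mul_smul])
  smul_add r x y := ext (smul_add _ _ _) (smul_add _ _ _)
  smul_zero r := ext (smul_zero _) (smul_zero _)
  add_smul r t x := ext (add_smul _ _ _) (by
    change star (r + t) • x.snd = star r • x.snd + star t • x.snd
    rw [star_add, add_smul])
  zero_smul x := ext (zero_smul _ _) (by change star (0 : R) • x.snd = 0; simp)

@[simp] theorem fst_smul (r : R) (x : Doubled B) : (r • x).fst = r • x.fst := rfl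
@[simp] theorem snd_smul (r : R) (x : Doubled B) : (r • x).snd = star r • x.snd := rfl

instance : IsScalarTower R (Doubled B) (Doubled B) where
  smul_assoc r x y := ext (by simp) (by simp)

instance : SMulCommClass R (Doubled B) (Doubled B) where
  smul_comm r x y := ext (by simp) (by simp)

instance : StarModule R (Doubled B) where
  star_smul r x := ext (by simp) (by simp)

theorem fst_sum {ι : Type*} (F : Finset ι) (f : ι → Doubled B) :
    (∑ i ∈ F, f i).fst = ∑ i ∈ F, (f i).fst :=
  map_sum (⟨⟨fst, rfl⟩, fun _ _ => rfl⟩ : Doubled B →+ B) f F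

theorem snd_sum {ι : Type*} (F : Finset ι) (f : ι → Doubled B) :
    (∑ i ∈ F, f i).snd = ∑ i ∈ F, (f i).snd :=
  map_sum (⟨⟨snd, rfl⟩, fun _ _ => rfl⟩ : Doubled B →+ B) f F

end Doubled

/-! ### Operators given by partial maps -/

open Classical in
/-- The operator on the free module on `X` sending the basis vector `x` to `f x` if `D x` holds and
to `0` otherwise. -/
noncomputable def partialOp (R : Type*) [CommRing R] {X : Type*} (D : X → Prop) (f : X → X) :
    Module.End R (X →₀ R) :=
  Finsupp.linearCombination R fun x => if D x then Finsupp.single (f x) 1 else 0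

section partialOp

variable {R : Type*} [CommRing R] {X : Type*} {D D' : X → Prop} {f f' : X → X}

theorem partialOp_pos {x : X} (h : D x) :
    partialOp R D f (Finsupp.single x 1) = Finsupp.single (f x) 1 := by
  simp [partialOp, h]

theorem partialOp_neg {x : X} (h : ¬ D x) : partialOp R D f (Finsupp.single x 1) = 0 := by
  simp [partialOp, h]

theorem End.ext_single {a b : Module.End R (X →₀ R)}
    (h : ∀ x, a (Finsupp.single x 1) = b (Finsupp.single x 1)) : a = b := by
  refine Finsupp.lhom_ext' fun x => LinearMap.ext_ring ?_
  exact h x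

theorem partialOp_congr (hD : ∀ x, D x ↔ D' x) (hf : ∀ x, D x → f x = f' x) :
    partialOp R D f = partialOp R D' f' := by
  refine End.ext_single fun x => ?_
  by_cases h : D x
  · rw [partialOp_pos h, partialOp_pos ((hD x).1 h), hf x h]
  · rw [partialOp_neg h, partialOp_neg (mt (hD x).2 h)]

theorem partialOp_eq_zero (hD : ∀ x, ¬ D x) : partialOp R D f = 0 :=
  End.ext_single fun x => partialOp_neg (hD x)

theorem partialOp_mul : partialOp R D f * partialOp R D' f' =
    partialOp R (fun x => D' x ∧ D (f' x)) (fun x => f (f' x)) := by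
  refine End.ext_single fun x => ?_
  rw [Module.End.mul_apply]
  by_cases h : D' x
  · rw [partialOp_pos h]
    by_cases h' : D (f' x)
    · rw [partialOp_pos h', partialOp_pos (by exact ⟨h, h'⟩)]
    · rw [partialOp_neg h', partialOp_neg fun hx => h' hx.2]
  · rw [partialOp_neg h, map_zero, partialOp_neg fun hx => h hx.1]

end partialOp

/-! ### Boundary systems -/

/-- A `G`-set `X` of sequences of edges, possibly with additional data, together with a subset of
points which is compatible with the shift. -/
structure BoundarySystem {G V Ed : Type*} [Group G] [MulAction G V] [MulAction G Ed]
    {E : RowFiniteGraph V Ed} (A : SelfSimilarAction G E) (X : Type*) [MulAction G X] where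
  head : X → Ed
  tail : X → X
  cons : Ed → X → X
  head_cons : ∀ e x, head (cons e x) = e
  tail_cons : ∀ e x, tail (cons e x) = x
  cons_head_tail : ∀ x, cons (head x) (tail x) = x
  smul_cons : ∀ (g : G) e x, g • cons e x = cons (g • e) (A.φ g e • x)
  carrier : Set X
  smul_mem : ∀ (g : G) x, x ∈ carrier → g • x ∈ carrier
  cons_mem : ∀ e x, x ∈ carrier → E.r (head x) = E.s e → cons e x ∈ carrier
  tail_mem : ∀ x, x ∈ carrier → tail x ∈ carrier
  range_tail : ∀ x, x ∈ carrier → E.r (head (tail x)) = E.s (head x)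

namespace SelfSimilarAction

variable {G V Ed : Type*} [Group G] [MulAction G V] [MulAction G Ed]
  {E : RowFiniteGraph V Ed} (A : SelfSimilarAction G E)

theorem φ_one (e : Ed) : A.φ 1 e = 1 := by
  have h := A.cocycle 1 1 e
  rw [one_smul, one_mul] at h
  exact left_eq_mul.mp h

theorem φ_inv_mul (g : G) (e : Ed) : A.φ g⁻¹ (g • e) * A.φ g e = 1 := by
  rw [← A.cocycle, inv_mul_cancel, A.φ_one]

end SelfSimilarAction

namespace BoundarySystem

variable {G V Ed : Type*} [Group G] [MulAction G V] [MulAction G Ed]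
  {E : RowFiniteGraph V Ed} {A : SelfSimilarAction G E} {X : Type*} [MulAction G X]
  (S : BoundarySystem A X)

/-- The range of a point. -/
def range (x : X) : V := E.r (S.head x)

theorem head_smul (g : G) (x : X) : S.head (g • x) = g • S.head x := by
  conv_lhs => rw [← S.cons_head_tail x, S.smul_cons, S.head_cons]

theorem tail_smul (g : G) (x : X) : S.tail (g • x) = A.φ g (S.head x) • S.tail x := by
  conv_lhs => rw [← S.cons_head_tail x, S.smul_cons, S.tail_cons]

theorem range_smul (g : G) (x : X) : S.range (g • x) = g • S.range x := by
  rw [range, head_smul, A.range_smul, range]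

theorem range_cons (e : Ed) (x : X) : S.range (S.cons e x) = E.r e := by
  rw [range, head_cons]

theorem smul_mem_iff (g : G) (x : X) : g • x ∈ S.carrier ↔ x ∈ S.carrier :=
  ⟨fun h => by simpa using S.smul_mem g⁻¹ _ h, S.smul_mem g x⟩

theorem cons_inj {e e' : Ed} {x x' : X} (h : S.cons e x = S.cons e' x') : e = e' ∧ x = x' := by
  constructor
  · rw [← S.head_cons e x, h, S.head_cons]
  · rw [← S.tail_cons e x, h, S.tail_cons]

variable (R : Type*) [CommRing R]

/-- The operator of `p_{v,f}`. -/
noncomputable def opP (v : V) (f : G) : Module.End R (X →₀ R) :=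
  partialOp R (fun x => x ∈ S.carrier ∧ S.range (f • x) = v) (fun x => f • x)

/-- The operator of `s_{e,g}`. -/
noncomputable def opS (e : Ed) (g : G) : Module.End R (X →₀ R) :=
  partialOp R (fun x => x ∈ S.carrier ∧ S.range (g • x) = E.s e) (fun x => S.cons e (g • x))

/-- The operator of `s_{e,g}^*`. -/
noncomputable def opSStar (e : Ed) (g : G) : Module.End R (X →₀ R) :=
  partialOp R (fun x => x ∈ S.carrier ∧ S.head x = e) (fun x => g⁻¹ • S.tail x)

theorem opP_mul_opP (v w : V) (f h : G) [Decidable (v = f • w)] :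
    S.opP R v f * S.opP R w h = if v = f • w then S.opP R v (f * h) else 0 := by
  rw [opP, opP, partialOp_mul]
  split_ifs with hv
  · refine partialOp_congr (fun x => ?_) fun x _ => (mul_smul _ _ _).symm
    simp only [smul_mem_iff, mul_smul, S.range_smul f, hv, smul_left_cancel_iff]
    tauto
  · refine partialOp_eq_zero fun x hx => hv ?_
    rw [← hx.2.2, S.range_smul f, hx.1.2]

theorem opP_mul_opS (v : V) (e : Ed) (f g : G) [Decidable (v = E.r (f • e))] :
    S.opP R v f * S.opS R e g =
      if v = E.r (f • e) then S.opS R (f • e) (A.φ f e * g) else 0 := by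
  rw [opP, opS, partialOp_mul]
  split_ifs with hv
  · refine partialOp_congr (fun x => ?_) fun x _ => by rw [S.smul_cons, mul_smul]
    simp only [S.smul_cons, S.range_cons, hv, mul_smul, S.range_smul (A.φ f e), A.φ_smul,
      A.source_smul, smul_left_cancel_iff, and_true]
    refine ⟨fun h => h.1, fun h => ⟨h, ?_⟩⟩
    exact S.cons_mem _ _ (S.smul_mem _ _ h.1) h.2
  · refine partialOp_eq_zero fun x hx => hv ?_
    rw [← hx.2.2, S.smul_cons, S.range_cons]

theorem opS_mul_opP (v : V) (e : Ed) (f g : G) [Decidable (g • v = E.s e)] :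
    S.opS R e g * S.opP R v f = if g • v = E.s e then S.opS R e (g * f) else 0 := by
  rw [opP, opS, partialOp_mul]
  split_ifs with hv
  · refine partialOp_congr (fun x => ?_) fun x _ => by rw [mul_smul]
    simp only [mul_smul, S.range_smul g, ← hv, smul_left_cancel_iff, smul_mem_iff]
    tauto
  · refine partialOp_eq_zero fun x hx => hv ?_
    rw [← hx.2.2, S.range_smul g, hx.1.2]

/-- The adjoint of the relation for `p_{v,f} s_{e,g}`. It has to be checked separately, because the
operators of the adjoints are defined by hand; `opP_mul_opSStar` plays the same role for `s_{e,g}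
p_{v,f}`. -/
theorem opSStar_mul_opP (v : V) (e : Ed) (f g : G) [Decidable (v = E.r (f • e))] :
    S.opSStar R e g * S.opP R (f⁻¹ • v) f⁻¹ =
      if v = E.r (f • e) then S.opSStar R (f • e) (A.φ f e * g) else 0 := by
  rw [opP, opSStar, partialOp_mul]
  have key : ∀ x, S.head (f⁻¹ • x) = e ↔ S.head x = f • e := fun x => by
    rw [S.head_smul, inv_smul_eq_iff]
  split_ifs with hv
  · refine partialOp_congr (fun x => ?_) fun x hx => ?_
    · simp only [smul_mem_iff, S.range_smul, key, smul_left_cancel_iff, hv]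
      refine ⟨fun h => ⟨h.1.1, h.2.2⟩, fun h => ⟨⟨h.1, ?_⟩, h.1, h.2⟩⟩
      rw [range, h.2]
    · rw [S.tail_smul, (key x).1 hx.2.2, mul_inv_rev, mul_smul,
        eq_inv_of_mul_eq_one_left (A.φ_inv_mul f e)]
  · refine partialOp_eq_zero fun x hx => hv ?_
    rw [← (key x).1 hx.2.2, ← range, ← smul_left_cancel_iff f⁻¹, ← S.range_smul, hx.1.2]

theorem opP_mul_opSStar (v : V) (e : Ed) (f g : G) [Decidable (g • v = E.s e)] :
    S.opP R (f⁻¹ • v) f⁻¹ * S.opSStar R e g =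
      if g • v = E.s e then S.opSStar R e (g * f) else 0 := by
  rw [opP, opSStar, partialOp_mul]
  have key : ∀ x, x ∈ S.carrier → S.head x = e →
      (S.range (f⁻¹ • g⁻¹ • S.tail x) = f⁻¹ • v ↔ g • v = E.s e) := fun x hx he => by
    rw [S.range_smul, S.range_smul, smul_left_cancel_iff, inv_smul_eq_iff, range,
      S.range_tail x hx, he]
    exact eq_comm
  split_ifs with hv
  · refine partialOp_congr (fun x => ?_) fun x _ => by rw [mul_inv_rev, mul_smul]
    refine ⟨fun h => h.1, fun h => ⟨h, S.smul_mem _ _ (S.tail_mem _ h.1), ?_⟩⟩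
    exact (key x h.1 h.2).2 hv
  · exact partialOp_eq_zero fun x hx => hv ((key x hx.1.1 hx.1.2).1 hx.2.2)

theorem opSStar_mul_opS (e : Ed) : S.opSStar R e 1 * S.opS R e 1 = S.opP R (E.s e) 1 := by
  rw [opP, opS, opSStar, partialOp_mul]
  refine partialOp_congr (fun x => ?_) fun x _ => by simp [S.tail_cons]
  simp only [one_smul, S.head_cons, and_true, and_iff_left_iff_imp]
  exact fun h => S.cons_mem _ _ h.1 h.2

theorem opSStar_mul_opS_of_ne {e f : Ed} (h : e ≠ f) : S.opSStar R e 1 * S.opS R f 1 = 0 := by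
  rw [opS, opSStar, partialOp_mul]
  refine partialOp_eq_zero fun x hx => h ?_
  rw [← hx.2.2, S.head_cons]

theorem opS_mul_opSStar (e : Ed) : S.opS R e 1 * S.opSStar R e 1 =
    partialOp R (fun x => x ∈ S.carrier ∧ S.head x = e) id := by
  rw [opS, opSStar, partialOp_mul]
  refine partialOp_congr (fun x => ?_) fun x hx => ?_
  · simp only [inv_one, one_smul]
    refine ⟨fun h => h.1, fun h => ⟨h, S.tail_mem _ h.1, ?_⟩⟩
    rw [range, S.range_tail x h.1, h.2]
  · simp only [inv_one, one_smul, id, ← hx.1.2, S.cons_head_tail]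

/-- The points with range `v` are partitioned by their first edge, and each summand is the
projection onto the points that start with `e`. -/
theorem opP_eq_sum (v : V) :
    S.opP R v 1 = ∑ e ∈ E.edgesTo v, S.opS R e 1 * S.opSStar R e 1 := by
  classical
  refine End.ext_single fun x => ?_
  simp only [opS_mul_opSStar, LinearMap.sum_apply]
  have mem_edgesTo : ∀ e, e ∈ E.edgesTo v ↔ E.r e = v := fun e => by
    simp [RowFiniteGraph.edgesTo]
  by_cases hx : x ∈ S.carrier ∧ S.range x = v
  · rw [opP, partialOp_pos (by simpa using hx), Finset.sum_eq_single (S.head x), partialOp_pos]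
    · simp
    · exact ⟨hx.1, rfl⟩
    · exact fun e _ he => partialOp_neg fun h => he h.2.symm
    · exact fun h => absurd ((mem_edgesTo _).2 hx.2) h
  · rw [opP, partialOp_neg (by simpa using hx), Finset.sum_eq_zero]
    refine fun e he => partialOp_neg fun h => hx ⟨h.1, ?_⟩
    rw [range, h.2, (mem_edgesTo e).1 he]

/-- The second component of each generator is the operator of its adjoint, so every relation becomes
a pair: the relation for operators and its reversed, adjoint form. -/
theorem isGEFamily :
    IsGEFamily A (fun v f => Doubled.mk (S.opP R v f) (S.opP R (f⁻¹ • v) f⁻¹))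
      (fun e g => Doubled.mk (S.opS R e g) (S.opSStar R e g)) where
  eFamily := by
    classical
    have hP : ∀ v w, S.opP R v 1 * S.opP R w 1 = if v = w then S.opP R v 1 else 0 := fun v w => by
      simpa using S.opP_mul_opP R v w 1 1
    have hS : ∀ e, S.opS R e 1 * S.opP R (E.s e) 1 = S.opS R e 1 := fun e => by
      simpa using S.opS_mul_opP R (E.s e) e 1 1
    have hS' : ∀ e, S.opP R (E.s e) 1 * S.opSStar R e 1 = S.opSStar R e 1 := fun e => by
      simpa using S.opP_mul_opSStar R (E.s e) e 1 1
    exact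
    { star_P := fun v => by ext1 <;> simp
      P_mul_self := fun v => by ext1 <;> simp [hP]
      P_mul_P := fun v w h => by ext1 <;> simp [hP, h, h.symm]
      partial_isometry := fun e => by
        ext1
        · simp [mul_assoc, opSStar_mul_opS, hS]
        · simp [← mul_assoc, opSStar_mul_opS, hS']
      star_S_mul_self := fun e => by ext1 <;> simp [opSStar_mul_opS]
      star_S_mul := fun e f h => by
        ext1
        · simp [opSStar_mul_opS_of_ne, h]
        · simp [opSStar_mul_opS_of_ne, h.symm]
      sum_range := fun v => by
        ext1
        · simp [Doubled.fst_sum, ← opP_eq_sum]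
        · simp [Doubled.snd_sum, ← opP_eq_sum] }
  star_P v f := by ext1 <;> simp
  P_mul_P v w f h := by
    classical
    ext1
    · simp only [Doubled.fst_mul, Doubled.fst_mk, opP_mul_opP]
      split_ifs <;> rfl
    · have key : h⁻¹ • w = h⁻¹ • f⁻¹ • v ↔ v = f • w := by
        rw [smul_left_cancel_iff, eq_inv_smul_iff, eq_comm]
      simp only [Doubled.snd_mul, Doubled.snd_mk, opP_mul_opP, mul_smul, mul_inv_rev,
        ← smul_eq_iff_eq_inv_smul]
      by_cases hv : v = f • w
      · rw [if_pos hv, if_pos (by simp [hv]), Doubled.snd_mk, hv, inv_smul_smul]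
      · rw [if_neg hv, if_neg (by simpa [eq_comm] using hv), Doubled.snd_zero]
  P_mul_S v e f g := by
    classical
    ext1
    · simp only [Doubled.fst_mul, Doubled.fst_mk, opP_mul_opS]
      split_ifs <;> rfl
    · simp only [Doubled.snd_mul, Doubled.snd_mk, opSStar_mul_opP]
      split_ifs <;> rfl
  S_mul_P v e f g := by
    classical
    ext1
    · simp only [Doubled.fst_mul, Doubled.fst_mk, opS_mul_opP]
      split_ifs <;> rfl
    · simp only [Doubled.snd_mul, Doubled.snd_mk, opP_mul_opSStar]
      split_ifs <;> rfl

/-! ### The representation attached to a boundary system -/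

variable [StarRing R]

/-- The representation of the Exel--Pardo algebra on the doubled operator algebra. -/
noncomputable def doubledRep :
    ExelPardoAlgebra R A →⋆ₙₐ[R] Doubled (Module.End R (X →₀ R)) :=
  (ExelPardoAlgebra.existsUnique_lift (S.isGEFamily R)).choose

/-- The representation of the Exel--Pardo algebra on the free module on `X`. -/
noncomputable def rep : ExelPardoAlgebra R A →ₙ+* Module.End R (X →₀ R) where
  toFun a := (S.doubledRep R a).fst
  map_mul' a b := by rw [map_mul, Doubled.fst_mul]
  map_zero' := by rw [map_zero, Doubled.fst_zero]
  map_add' a b := by rw [map_add, Doubled.fst_add]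

variable {R}

theorem rep_smul (c : R) (a : ExelPardoAlgebra R A) : S.rep R (c • a) = c • S.rep R a := by
  change (S.doubledRep R (c • a)).fst = c • (S.doubledRep R a).fst
  rw [map_smul, Doubled.fst_smul]

theorem rep_p (v : V) (f : G) : S.rep R (ExelPardoAlgebra.p R A v f) = S.opP R v f :=
  congrArg Doubled.fst
    ((ExelPardoAlgebra.existsUnique_lift (S.isGEFamily R)).choose_spec.1.1 v f)

theorem rep_s (e : Ed) (g : G) : S.rep R (ExelPardoAlgebra.s R A e g) = S.opS R e g :=
  congrArg Doubled.fst
    ((ExelPardoAlgebra.existsUnique_lift (S.isGEFamily R)).choose_spec.1.2 e g)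

theorem rep_star_s (e : Ed) (g : G) :
    S.rep R (star (ExelPardoAlgebra.s R A e g)) = S.opSStar R e g := by
  change (S.doubledRep R (star (ExelPardoAlgebra.s R A e g))).fst = _
  rw [map_star, Doubled.fst_star]
  exact congrArg Doubled.snd
    ((ExelPardoAlgebra.existsUnique_lift (S.isGEFamily R)).choose_spec.1.2 e g)

theorem nontrivial_of_isSimpleRing (A : SelfSimilarAction G E)
    [IsSimpleRing (ExelPardoAlgebra R A)] : Nontrivial R := by
  by_contra h
  rw [not_nontrivial_iff_subsingleton] at h
  have h0 : ∀ a : ExelPardoAlgebra R A, a = 0 := fun a => by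
    rw [← one_smul R a, Subsingleton.elim (1 : R) 0, zero_smul]
  obtain ⟨x, y, hxy⟩ := exists_pair_ne (ExelPardoAlgebra R A)
  exact hxy ((h0 x).trans (h0 y).symm)

/-- The kernel is a two-sided ideal, and it is proper because the vertex projection at the range of
a point of the carrier fixes that point. -/
theorem rep_injective [IsSimpleRing (ExelPardoAlgebra R A)] (hne : S.carrier.Nonempty) :
    Function.Injective (S.rep R) := by
  have := nontrivial_of_isSimpleRing (R := R) A
  obtain ⟨x, hx⟩ := hne
  rcases eq_bot_or_eq_top (TwoSidedIdeal.ker (S.rep R)) with h | h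
  · exact TwoSidedIdeal.ker_eq_bot _ |>.1 h
  · exfalso
    have h1 : ExelPardoAlgebra.p R A (S.range x) 1 ∈ TwoSidedIdeal.ker (S.rep R) := by
      rw [h]; trivial
    rw [TwoSidedIdeal.mem_ker, rep_p] at h1
    have h2 : S.opP R (S.range x) 1 (Finsupp.single x 1) = Finsupp.single ((1 : G) • x) 1 :=
      partialOp_pos (by simpa using hx)
    rw [h1, LinearMap.zero_apply] at h2
    exact Finsupp.single_ne_zero.2 one_ne_zero h2.symm

end BoundarySystem

/-! ### Words -/

namespace RowFiniteGraph

variable {V Ed : Type*} (E : RowFiniteGraph V Ed)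

/-- The range of the path with list of edges `l` and source `w`. -/
def rangeOf : List Ed → V → V
  | [], w => w
  | e :: _, _ => E.r e

/-- The list of edges `l` is a path with source `w`. -/
def IsPathFrom {V Ed : Type*} (E : RowFiniteGraph V Ed) : List Ed → V → Prop
  | [], _ => True
  | e :: l, w => E.rangeOf l w = E.s e ∧ E.IsPathFrom l w

theorem isPathFrom_of_isPathTo {v : V} {l : List Ed} (h : E.IsPathTo v l) :
    E.IsPathFrom l (E.sourceOf v l) ∧ E.rangeOf l (E.sourceOf v l) = v := by
  induction l generalizing v with
  | nil => exact ⟨trivial, rfl⟩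
  | cons e l ih => exact ⟨⟨(ih h.2).2, (ih h.2).1⟩, h.1⟩

theorem sourceOf_append (v : V) (l l' : List Ed) :
    E.sourceOf v (l ++ l') = E.sourceOf (E.sourceOf v l) l' := by
  induction l generalizing v with
  | nil => rfl
  | cons e l ih => exact ih _

theorem isPathTo_append {v : V} {l l' : List Ed} (h : E.IsPathTo v l)
    (h' : E.IsPathTo (E.sourceOf v l) l') : E.IsPathTo v (l ++ l') := by
  induction l generalizing v with
  | nil => exact h'
  | cons e l ih => exact ⟨h.1, ih h.2 h'⟩

end RowFiniteGraph

theorem SelfSimilarAction.sourceOf_actList {G V Ed : Type*} [Group G] [MulAction G V]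
    [MulAction G Ed] {E : RowFiniteGraph V Ed} (A : SelfSimilarAction G E) (g : G) (v : V)
    (l : List Ed) : E.sourceOf (g • v) (A.actList g l) = g • E.sourceOf v l := by
  induction l generalizing g v with
  | nil => rfl
  | cons e l ih =>
    change E.sourceOf (E.s (g • e)) (A.actList (A.φ g e) l) = g • E.sourceOf (E.s e) l
    rw [A.source_smul, ← A.φ_smul g e, ih, A.φ_smul]

/-- The element `s_l p_{w,g}`. -/
def monomial (R : Type*) [CommRing R] [StarRing R] {G V Ed : Type*} [Group G]
    [MulAction G V] [MulAction G Ed] {E : RowFiniteGraph V Ed} (A : SelfSimilarAction G E)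
    (l : List Ed) (w : V) (g : G) : ExelPardoAlgebra R A :=
  l.foldr (fun e b => ExelPardoAlgebra.s R A e 1 * b) (ExelPardoAlgebra.p R A w g)

/-! ### Monomials as partial bijections of points -/

namespace BoundarySystem

variable {G V Ed : Type*} [Group G] [MulAction G V] [MulAction G Ed]
  {E : RowFiniteGraph V Ed} {A : SelfSimilarAction G E} {X : Type*} [MulAction G X]
  (S : BoundarySystem A X)

/-- Concatenation of a word and a point. -/
def app (l : List Ed) (x : X) : X := l.foldr S.cons x

@[simp] theorem app_nil (x : X) : S.app [] x = x := rfl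

@[simp] theorem app_cons (e : Ed) (l : List Ed) (x : X) :
    S.app (e :: l) x = S.cons e (S.app l x) := rfl

theorem range_app (l : List Ed) (x : X) : S.range (S.app l x) = E.rangeOf l (S.range x) := by
  cases l with
  | nil => rfl
  | cons e l => exact S.range_cons _ _

theorem app_mem {l : List Ed} {x : X} (hx : x ∈ S.carrier) (hl : E.IsPathFrom l (S.range x)) :
    S.app l x ∈ S.carrier := by
  induction l with
  | nil => exact hx
  | cons e l ih =>
    refine S.cons_mem _ _ (ih hl.2) ?_
    change S.range (S.app l x) = E.s e
    rw [range_app, hl.1]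

variable {R : Type*} [CommRing R] [StarRing R]

open Classical in
theorem rep_p_single (v : V) (g : G) (x : X) :
    S.rep R (ExelPardoAlgebra.p R A v g) (Finsupp.single x 1) =
      if x ∈ S.carrier ∧ S.range (g • x) = v then Finsupp.single (g • x) 1 else 0 := by
  rw [rep_p, opP]
  split_ifs with h
  exacts [partialOp_pos h, partialOp_neg h]

theorem rep_p_one_single_pos {x : X} (hx : x ∈ S.carrier) :
    S.rep R (ExelPardoAlgebra.p R A (S.range x) 1) (Finsupp.single x 1) = Finsupp.single x 1 := by
  rw [rep_p_single, if_pos (by simpa using hx), one_smul]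

theorem rep_p_one_single_neg {v : V} {x : X} (hx : ¬ (x ∈ S.carrier ∧ S.range x = v)) :
    S.rep R (ExelPardoAlgebra.p R A v 1) (Finsupp.single x 1) = 0 := by
  rw [rep_p_single, if_neg (by simpa using hx)]

theorem rep_monomial_pos {l : List Ed} {w : V} {g : G} {x : X} (hx : x ∈ S.carrier)
    (hw : S.range (g • x) = w) (hl : E.IsPathFrom l w) :
    S.rep R (monomial R A l w g) (Finsupp.single x 1) =
      Finsupp.single (S.app l (g • x)) 1 := by
  induction l with
  | nil =>
    change S.rep R (ExelPardoAlgebra.p R A w g) _ = _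
    rw [rep_p_single, if_pos ⟨hx, hw⟩]
    rfl
  | cons e l ih =>
    change S.rep R (ExelPardoAlgebra.s R A e 1 * monomial R A l w g) _ = _
    have hm : S.app l (g • x) ∈ S.carrier := S.app_mem (S.smul_mem _ _ hx) (hw ▸ hl.2)
    have hr : S.range (S.app l (g • x)) = E.s e := by rw [range_app, hw, hl.1]
    rw [map_mul, Module.End.mul_apply, ih hl.2, rep_s, opS,
      partialOp_pos ⟨hm, by rwa [one_smul]⟩, one_smul, app_cons]

theorem rep_monomial_neg {l : List Ed} {w : V} {g : G} {x : X}
    (h : ¬ (x ∈ S.carrier ∧ S.range (g • x) = w ∧ E.IsPathFrom l w)) :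
    S.rep R (monomial R A l w g) (Finsupp.single x 1) = 0 := by
  induction l with
  | nil =>
    change S.rep R (ExelPardoAlgebra.p R A w g) _ = _
    rw [rep_p_single, if_neg fun h' => h ⟨h'.1, h'.2, trivial⟩]
  | cons e l ih =>
    change S.rep R (ExelPardoAlgebra.s R A e 1 * monomial R A l w g) _ = _
    rw [map_mul, Module.End.mul_apply]
    by_cases hl : x ∈ S.carrier ∧ S.range (g • x) = w ∧ E.IsPathFrom l w
    · rw [rep_monomial_pos S hl.1 hl.2.1 hl.2.2, rep_s, opS, partialOp_neg]
      rw [one_smul, range_app, hl.2.1]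
      exact fun h' => h ⟨hl.1, hl.2.1, h'.2, hl.2.2⟩
    · rw [ih hl, map_zero]

theorem star_monomial_cons (e : Ed) (l : List Ed) (w : V) (g : G) :
    star (monomial R A (e :: l) w g) =
      star (monomial R A l w g) * star (ExelPardoAlgebra.s R A e 1) :=
  star_mul _ _

theorem star_monomial_nil (w : V) (g : G) :
    star (monomial R A [] w g) = ExelPardoAlgebra.p R A (g⁻¹ • w) g⁻¹ :=
  (ExelPardoAlgebra.isGEFamily R A).star_P w g

/-- The map x ↦ l(g·x) is injective. The adjoint of a monomial acts as its inverse on the image and,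
by `rep_star_monomial_neg`, as zero off the image. -/
theorem rep_star_monomial_pos {l : List Ed} {w : V} {g : G} {x : X} (hx : x ∈ S.carrier)
    (hw : S.range (g • x) = w) (hl : E.IsPathFrom l w) :
    S.rep R (star (monomial R A l w g)) (Finsupp.single (S.app l (g • x)) 1) =
      Finsupp.single x 1 := by
  induction l with
  | nil =>
    rw [star_monomial_nil, rep_p_single, if_pos, app_nil, inv_smul_smul]
    refine ⟨S.smul_mem _ _ hx, ?_⟩
    rw [app_nil, range_smul, hw]
  | cons e l ih =>
    rw [star_monomial_cons, map_mul, Module.End.mul_apply, rep_star_s, opSStar, partialOp_pos]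
    · simp only [inv_one, one_smul, app_cons, S.tail_cons]
      exact ih hl.2
    · exact ⟨S.app_mem (S.smul_mem _ _ hx) (hw ▸ hl), S.head_cons _ _⟩

theorem rep_star_monomial_neg {l : List Ed} {w : V} {g : G} {y : X}
    (h : ∀ x ∈ S.carrier, S.range (g • x) = w → S.app l (g • x) ≠ y) :
    S.rep R (star (monomial R A l w g)) (Finsupp.single y 1) = 0 := by
  induction l generalizing y with
  | nil =>
    rw [star_monomial_nil, rep_p_single, if_neg]
    rintro ⟨hy, hr⟩
    refine h (g⁻¹ • y) (S.smul_mem _ _ hy) ?_ (by rw [app_nil, smul_inv_smul])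
    rw [range_smul, hr, smul_inv_smul]
  | cons e l ih =>
    rw [star_monomial_cons, map_mul, Module.End.mul_apply, rep_star_s, opSStar]
    by_cases hy : y ∈ S.carrier ∧ S.head y = e
    · rw [partialOp_pos (by exact hy), inv_one, one_smul]
      refine ih fun x hx hw he => h x hx hw ?_
      rw [app_cons, he, ← hy.2, S.cons_head_tail]
    · rw [partialOp_neg (by exact hy), map_zero]

end BoundarySystem

/-! ### Spans of monomials -/

namespace ExelPardoAlgebra

variable {R : Type*} [CommRing R] [StarRing R] {G V Ed : Type*} [Group G]
  [MulAction G V] [MulAction G Ed] {E : RowFiniteGraph V Ed} {A : SelfSimilarAction G E}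

theorem s_one_mul_p (e : Ed) (g : G) : s R A e 1 * p R A (E.s e) g = s R A e g := by
  rw [(isGEFamily R A).S_mul_P, if_pos (one_smul _ _), one_mul]

theorem p_mul_p_one (w : V) : p R A w 1 * p R A w 1 = p R A w 1 :=
  (isGEFamily R A).eFamily.P_mul_self w

/-- The group element is pushed through the word one letter at a time by the cocycle, so the length
of the word is kept. -/
theorem p_mul_monomial (w : V) (f : G) (l : List Ed) (v : V) (g : G) :
    p R A w f * monomial R A l v g = 0 ∨
      ∃ l' v' g', l'.length = l.length ∧
        p R A w f * monomial R A l v g = monomial R A l' v' g' := by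
  induction l generalizing w f with
  | nil =>
    change p R A w f * p R A v g = 0 ∨ _
    by_cases h : w = f • v
    · refine Or.inr ⟨[], w, f * g, rfl, ?_⟩
      change p R A w f * p R A v g = p R A w (f * g)
      rw [(isGEFamily R A).P_mul_P, if_pos h]
    · left
      rw [(isGEFamily R A).P_mul_P, if_neg h]
  | cons e l ih =>
    have h1 : p R A w f * monomial R A (e :: l) v g =
        p R A w f * s R A e 1 * monomial R A l v g := (mul_assoc _ _ _).symm
    rw [h1, (isGEFamily R A).P_mul_S]
    by_cases h : w = E.r (f • e)
    · rw [if_pos h, mul_one, ← s_one_mul_p, mul_assoc]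
      rcases ih (E.s (f • e)) (A.φ f e) with h0 | ⟨l', v', g', hl, h0⟩
      · left
        rw [h0, mul_zero]
      · refine Or.inr ⟨(f • e) :: l', v', g', by simp [hl], ?_⟩
        rw [h0]
        rfl
    · left
      rw [if_neg h, zero_mul]

/-- The span of the monomials whose word has length at least `k`. -/
def monomialSpan (R : Type*) [CommRing R] [StarRing R] {G V Ed : Type*} [Group G]
    [MulAction G V] [MulAction G Ed] {E : RowFiniteGraph V Ed} (A : SelfSimilarAction G E)
    (k : ℕ) : Submodule R (ExelPardoAlgebra R A) :=
  Submodule.span R {t | ∃ l v g, k ≤ l.length ∧ t = monomial R A l v g}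

theorem monomial_mem_monomialSpan {k : ℕ} {l : List Ed} (h : k ≤ l.length) (v : V) (g : G) :
    monomial R A l v g ∈ monomialSpan R A k :=
  Submodule.subset_span ⟨l, v, g, h, rfl⟩

/-- Left multiplication by `a` maps monomials of sufficiently long words to combinations of
monomials of long words. -/
def ShiftsMonomials (a : ExelPardoAlgebra R A) : Prop :=
  ∀ k, ∃ N, ∀ x ∈ monomialSpan R A N, a * x ∈ monomialSpan R A k

theorem ShiftsMonomials.of_monomial {a : ExelPardoAlgebra R A}
    (h : ∀ k, ∃ N, ∀ l v g, N ≤ l.length → a * monomial R A l v g ∈ monomialSpan R A k) :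
    ShiftsMonomials a := by
  intro k
  obtain ⟨N, hN⟩ := h k
  refine ⟨N, fun x hx => ?_⟩
  induction hx using Submodule.span_induction with
  | mem x hx =>
    obtain ⟨l, v, g, hl, rfl⟩ := hx
    exact hN l v g hl
  | zero => rw [mul_zero]; exact zero_mem _
  | add x y _ _ hx hy => rw [mul_add]; exact add_mem hx hy
  | smul c x _ hx => rw [mul_smul_comm]; exact Submodule.smul_mem _ _ hx

theorem monomialSpan_anti {k k' : ℕ} (h : k ≤ k') : monomialSpan R A k' ≤ monomialSpan R A k :=
  Submodule.span_mono fun _ ⟨l, v, g, hl, ht⟩ => ⟨l, v, g, h.trans hl, ht⟩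

theorem ShiftsMonomials.add {a b : ExelPardoAlgebra R A} (ha : ShiftsMonomials a)
    (hb : ShiftsMonomials b) : ShiftsMonomials (a + b) := by
  intro k
  obtain ⟨N, hN⟩ := ha k
  obtain ⟨M, hM⟩ := hb k
  refine ⟨max N M, fun x hx => ?_⟩
  rw [add_mul]
  exact add_mem (hN _ (monomialSpan_anti (le_max_left _ _) hx))
    (hM _ (monomialSpan_anti (le_max_right _ _) hx))

theorem ShiftsMonomials.mul {a b : ExelPardoAlgebra R A} (ha : ShiftsMonomials a)
    (hb : ShiftsMonomials b) : ShiftsMonomials (a * b) := by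
  intro k
  obtain ⟨N, hN⟩ := ha k
  obtain ⟨M, hM⟩ := hb N
  exact ⟨M, fun x hx => by rw [mul_assoc]; exact hN _ (hM _ hx)⟩

theorem ShiftsMonomials.smul {a : ExelPardoAlgebra R A} (ha : ShiftsMonomials a) (c : R) :
    ShiftsMonomials (c • a) := by
  intro k
  obtain ⟨N, hN⟩ := ha k
  exact ⟨N, fun x hx => by rw [smul_mul_assoc]; exact Submodule.smul_mem _ _ (hN _ hx)⟩

theorem shiftsMonomials_zero : ShiftsMonomials (0 : ExelPardoAlgebra R A) :=
  fun k => ⟨0, fun x _ => by rw [zero_mul]; exact zero_mem _⟩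

theorem shiftsMonomials_p (w : V) (f : G) : ShiftsMonomials (p R A w f) := by
  refine .of_monomial fun k => ⟨k, fun l v g hl => ?_⟩
  rcases p_mul_monomial (R := R) (A := A) w f l v g with h | ⟨l', v', g', hl', h⟩
  · rw [h]
    exact zero_mem _
  · rw [h]
    exact monomial_mem_monomialSpan (by omega) _ _

theorem shiftsMonomials_s (e : Ed) (g : G) : ShiftsMonomials (s R A e g) := by
  rw [← s_one_mul_p]
  refine ShiftsMonomials.mul (.of_monomial fun k => ⟨k, fun l v h hl => ?_⟩)
    (shiftsMonomials_p _ _)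
  exact monomial_mem_monomialSpan (l := e :: l) (hl.trans (Nat.le_succ _)) v h

theorem shiftsMonomials_star_s (e : Ed) (g : G) : ShiftsMonomials (star (s R A e g)) := by
  rw [← s_one_mul_p, star_mul, (isGEFamily R A).star_P]
  refine ShiftsMonomials.mul (shiftsMonomials_p _ _)
    -- The adjoint of an edge consumes one letter; only the empty word would not give a monomial.
    (.of_monomial fun k => ⟨k + 1, fun l v h hl => ?_⟩)
  obtain _ | ⟨e', l⟩ := l
  · simp at hl
  have h1 : star (s R A e 1) * monomial R A (e' :: l) v h =
      star (s R A e 1) * s R A e' 1 * monomial R A l v h := (mul_assoc _ _ _).symm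
  rw [h1]
  by_cases he : e = e'
  · subst he
    rw [(isGEFamily R A).eFamily.star_S_mul_self]
    rcases p_mul_monomial (R := R) (A := A) (E.s e) 1 l v h with h | ⟨l', v', g', hl', h⟩
    · rw [h]
      exact zero_mem _
    · rw [h]
      refine monomial_mem_monomialSpan ?_ _ _
      simp only [List.length_cons] at hl
      omega
  · rw [(isGEFamily R A).eFamily.star_S_mul e e' he, zero_mul]
    exact zero_mem _

/-- A generator or its adjoint shortens a word by at most one letter, and the property is stable
under sums, products and scalars. -/
theorem shiftsMonomials (a : ExelPardoAlgebra R A) :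
    ShiftsMonomials a := by
  -- The involution is one of the formal operations, so the induction has to carry the adjoint
  -- along.
  suffices h : ShiftsMonomials a ∧ ShiftsMonomials (star a) from h.1
  obtain ⟨a⟩ := a
  induction a with
  | p v f =>
    refine ⟨shiftsMonomials_p v f, ?_⟩
    change ShiftsMonomials (star (p R A v f))
    rw [(isGEFamily R A).star_P]
    exact shiftsMonomials_p _ _
  | s e g => exact ⟨shiftsMonomials_s e g, shiftsMonomials_star_s e g⟩
  | zero =>
    change ShiftsMonomials (0 : ExelPardoAlgebra R A) ∧
      ShiftsMonomials (star (0 : ExelPardoAlgebra R A))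
    rw [star_zero]
    exact ⟨shiftsMonomials_zero, shiftsMonomials_zero⟩
  | add a b iha ihb =>
    change ShiftsMonomials (mk R A a + mk R A b) ∧ ShiftsMonomials (star (mk R A a + mk R A b))
    rw [star_add]
    exact ⟨iha.1.add ihb.1, iha.2.add ihb.2⟩
  | neg a ih =>
    change ShiftsMonomials (-mk R A a) ∧ ShiftsMonomials (star (-mk R A a))
    rw [star_neg, ← neg_one_smul R (mk R A a), ← neg_one_smul R (star (mk R A a))]
    exact ⟨ih.1.smul _, ih.2.smul _⟩
  | smul r a ih =>
    change ShiftsMonomials (r • mk R A a) ∧ ShiftsMonomials (star (r • mk R A a))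
    rw [star_smul]
    exact ⟨ih.1.smul _, ih.2.smul _⟩
  | mul a b iha ihb =>
    change ShiftsMonomials (mk R A a * mk R A b) ∧ ShiftsMonomials (star (mk R A a * mk R A b))
    rw [star_mul]
    exact ⟨iha.1.mul ihb.1, ihb.2.mul iha.2⟩
  | star a ih =>
    change ShiftsMonomials (star (mk R A a)) ∧ ShiftsMonomials (star (star (mk R A a)))
    rw [star_star]
    exact ⟨ih.2, ih.1⟩

/-- In a simple Exel--Pardo algebra nonzero multiples of `p_v` generate `p_v`. -/
theorem exists_smul_p_mul_eq [IsSimpleRing (ExelPardoAlgebra R A)] {c : R} {w : V}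
    (h : c • p R A w 1 ≠ 0) : ∃ d, c • p R A w 1 * d = p R A w 1 := by
  -- The multiples of the central scalar c form a nonzero ideal, hence everything. Thus p_w = c·d
  -- for some d, and c p_w d = p_w p_w = p_w.
  let I : TwoSidedIdeal (ExelPardoAlgebra R A) :=
    .mk' (Set.range fun b => c • b) ⟨0, smul_zero c⟩
      (by rintro _ _ ⟨a, rfl⟩ ⟨b, rfl⟩; exact ⟨a + b, smul_add _ _ _⟩)
      (by rintro _ ⟨a, rfl⟩; exact ⟨-a, smul_neg _ _⟩)
      (by rintro a _ ⟨b, rfl⟩; exact ⟨a * b, (mul_smul_comm _ _ _).symm⟩)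
      (by rintro _ b ⟨a, rfl⟩; exact ⟨a * b, (smul_mul_assoc _ _ _).symm⟩)
  have hI : ∀ x, x ∈ I ↔ x ∈ Set.range fun b => c • b := fun x => TwoSidedIdeal.mem_mk' ..
  have htop : I = ⊤ := by
    refine (eq_bot_or_eq_top I).resolve_left fun hbot => h ?_
    have : c • p R A w 1 ∈ I := (hI _).2 ⟨_, rfl⟩
    rwa [hbot, TwoSidedIdeal.mem_bot] at this
  obtain ⟨d, hd⟩ := (hI (p R A w 1)).1 (htop ▸ trivial)
  refine ⟨d, ?_⟩
  change c • d = _ at hd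
  rw [smul_mul_assoc, ← mul_smul_comm, hd, p_mul_p_one]

end ExelPardoAlgebra

/-! ### Initial words and the local form of an element -/

namespace BoundarySystem

open ExelPardoAlgebra

variable {G V Ed : Type*} [Group G] [MulAction G V] [MulAction G Ed]
  {E : RowFiniteGraph V Ed} {A : SelfSimilarAction G E} {X : Type*} [MulAction G X]
  (S : BoundarySystem A X)

/-- The initial word of length `n` of a point. -/
def word : ℕ → X → List Ed
  | 0, _ => []
  | n + 1, x => S.head x :: word n (S.tail x)

theorem length_word (n : ℕ) (x : X) : (S.word n x).length = n := by
  induction n generalizing x with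
  | zero => rfl
  | succ n ih => simp [word, ih]

theorem app_word (n : ℕ) (x : X) : S.app (S.word n x) (S.tail^[n] x) = x := by
  induction n generalizing x with
  | zero => rfl
  | succ n ih => rw [word, app_cons, Function.iterate_succ_apply, ih, S.cons_head_tail]

theorem iterate_tail_mem (n : ℕ) {x : X} (hx : x ∈ S.carrier) : S.tail^[n] x ∈ S.carrier := by
  induction n generalizing x with
  | zero => exact hx
  | succ n ih => exact ih (S.tail_mem x hx)

theorem isPathTo_word (n : ℕ) {x : X} (hx : x ∈ S.carrier) :
    E.IsPathTo (S.range x) (S.word n x) := by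
  induction n generalizing x with
  | zero => trivial
  | succ n ih =>
    refine ⟨rfl, ?_⟩
    rw [← S.range_tail x hx]
    exact ih (S.tail_mem x hx)

theorem sourceOf_word (n : ℕ) {x : X} (hx : x ∈ S.carrier) :
    E.sourceOf (S.range x) (S.word n x) = S.range (S.tail^[n] x) := by
  induction n generalizing x with
  | zero => rfl
  | succ n ih =>
    have h := ih (S.tail_mem x hx)
    rw [range, S.range_tail x hx] at h
    exact h

theorem isPathFrom_word (n : ℕ) {x : X} (hx : x ∈ S.carrier) :
    E.IsPathFrom (S.word n x) (S.range (S.tail^[n] x)) := by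
  rw [← S.sourceOf_word n hx]
  exact (E.isPathFrom_of_isPathTo (S.isPathTo_word n hx)).1

variable {R : Type*} [CommRing R] [StarRing R]

/-- The generators and their adjoints are defined only on the carrier. So a point on which an
element does not vanish is a genuine point of the system. -/
theorem rep_single_of_not_mem (a : ExelPardoAlgebra R A) {x : X} (hx : x ∉ S.carrier) :
    S.rep R a (Finsupp.single x 1) = 0 := by
  suffices h : S.rep R a (Finsupp.single x 1) = 0 ∧ S.rep R (star a) (Finsupp.single x 1) = 0
    from h.1
  obtain ⟨a⟩ := a
  induction a with
  | p v f =>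
    change S.rep R (p R A v f) _ = 0 ∧ S.rep R (star (p R A v f)) _ = 0
    rw [(ExelPardoAlgebra.isGEFamily R A).star_P, rep_p_single, rep_p_single]
    exact ⟨if_neg fun h => hx h.1, if_neg fun h => hx h.1⟩
  | s e g =>
    change S.rep R (s R A e g) _ = 0 ∧ S.rep R (star (s R A e g)) _ = 0
    rw [rep_s, rep_star_s]
    exact ⟨partialOp_neg fun h => hx h.1, partialOp_neg fun h => hx h.1⟩
  | zero =>
    change S.rep R 0 _ = 0 ∧ S.rep R (star 0) _ = 0
    simp
  | add a b iha ihb =>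
    change S.rep R (ExelPardoAlgebra.mk R A a + ExelPardoAlgebra.mk R A b) _ = 0 ∧
      S.rep R (star (ExelPardoAlgebra.mk R A a + ExelPardoAlgebra.mk R A b)) _ = 0
    rw [star_add, map_add, map_add, LinearMap.add_apply, LinearMap.add_apply]
    exact ⟨(congrArg₂ (· + ·) iha.1 ihb.1).trans (add_zero 0),
      (congrArg₂ (· + ·) iha.2 ihb.2).trans (add_zero 0)⟩
  | neg a ih =>
    change S.rep R (-ExelPardoAlgebra.mk R A a) _ = 0 ∧ S.rep R (star (-ExelPardoAlgebra.mk R A a)) _ = 0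
    rw [star_neg, map_neg, map_neg, LinearMap.neg_apply, LinearMap.neg_apply, neg_eq_zero,
      neg_eq_zero]
    exact ih
  | smul r a ih =>
    change S.rep R (r • ExelPardoAlgebra.mk R A a) _ = 0 ∧ S.rep R (star (r • ExelPardoAlgebra.mk R A a)) _ = 0
    rw [star_smul, rep_smul, rep_smul, LinearMap.smul_apply, LinearMap.smul_apply]
    exact ⟨by rw [show S.rep R (ExelPardoAlgebra.mk R A a) _ = 0 from ih.1, smul_zero],
      by rw [show S.rep R (star (ExelPardoAlgebra.mk R A a)) _ = 0 from ih.2, smul_zero]⟩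
  | mul a b iha ihb =>
    change S.rep R (ExelPardoAlgebra.mk R A a * ExelPardoAlgebra.mk R A b) _ = 0 ∧
      S.rep R (star (ExelPardoAlgebra.mk R A a * ExelPardoAlgebra.mk R A b)) _ = 0
    rw [star_mul, map_mul, map_mul, Module.End.mul_apply, Module.End.mul_apply]
    exact ⟨by rw [show S.rep R (ExelPardoAlgebra.mk R A b) _ = 0 from ihb.1, map_zero],
      by rw [show S.rep R (star (ExelPardoAlgebra.mk R A a)) _ = 0 from iha.2, map_zero]⟩
  | star a ih =>
    change S.rep R (star (ExelPardoAlgebra.mk R A a)) _ = 0 ∧ S.rep R (star (star (ExelPardoAlgebra.mk R A a))) _ = 0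
    rw [star_star]
    exact ⟨ih.2, ih.1⟩

/-- Up to right multiplication, a nonzero element acts near some point as a finite combination of
the maps `z ↦ l (g z)`. -/
theorem exists_local_form (hinj : Function.Injective (S.rep R)) {a : ExelPardoAlgebra R A}
    (ha : a ≠ 0) :
    ∃ (m : ExelPardoAlgebra R A) (x : X) (F : Finset (List Ed × G)) (c : List Ed × G → R),
      x ∈ S.carrier ∧ (∀ i ∈ F, E.IsPathFrom i.1 (i.2 • S.range x)) ∧
      (∀ z ∈ S.carrier, S.range z = S.range x → S.rep R (a * m) (Finsupp.single z 1) =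
        ∑ i ∈ F, Finsupp.single (S.app i.1 (i.2 • z)) (c i)) ∧
      ∑ i ∈ F, Finsupp.single (S.app i.1 (i.2 • x)) (c i) ≠ 0 := by
  classical
  obtain ⟨x, hx⟩ : ∃ x, S.rep R a (Finsupp.single x 1) ≠ 0 := by
    by_contra! h
    exact ha (hinj (End.ext_single fun x => by rw [h x, map_zero, LinearMap.zero_apply]))
  have hxC : x ∈ S.carrier := by
    by_contra h
    exact hx (S.rep_single_of_not_mem a h)
  obtain ⟨N, hN⟩ := shiftsMonomials a 0
  have hx'C := S.iterate_tail_mem N hxC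
  set x' := S.tail^[N] x with hx'
  -- This monomial puts the first N edges of x back in front of its tail x', so a * m does at x'
  -- what a does at x.
  set m := monomial R A (S.word N x) (S.range x') 1 with hm
  have hb := hN m (monomial_mem_monomialSpan (S.length_word N x).ge _ _)
  have hrep : S.rep R (a * m) (Finsupp.single x' 1) ≠ 0 := by
    rw [map_mul, Module.End.mul_apply, hm, S.rep_monomial_pos hx'C (by rw [one_smul])
      (S.isPathFrom_word N hxC), one_smul, hx', S.app_word]
    exact hx
  have hb' : a * m ∈ Submodule.span R
      (Set.range fun t : List Ed × V × G => monomial R A t.1 t.2.1 t.2.2) := by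
    refine Submodule.span_mono ?_ hb
    rintro _ ⟨l, v, g, -, rfl⟩
    exact ⟨(l, v, g), rfl⟩
  obtain ⟨c, hc⟩ := (Finsupp.mem_span_range_iff_exists_finsupp).1 hb'
  -- Which monomials act non-trivially depends only on the range of z, so the same index set serves
  -- all these points.
  have key : ∀ z ∈ S.carrier, S.range z = S.range x' → S.rep R (a * m) (Finsupp.single z 1) =
      ∑ t ∈ c.support with t.2.1 = t.2.2 • S.range x' ∧ E.IsPathFrom t.1 t.2.1,
        Finsupp.single (S.app t.1 (t.2.2 • z)) (c t) := by
    intro z hz hzr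
    rw [← hc, Finsupp.sum, map_sum, LinearMap.sum_apply, Finset.sum_filter]
    refine Finset.sum_congr rfl fun t _ => ?_
    rw [rep_smul, LinearMap.smul_apply]
    split_ifs with ht
    · rw [S.rep_monomial_pos hz (by rw [S.range_smul, hzr, ht.1]) ht.2, Finsupp.smul_single,
        smul_eq_mul, mul_one]
    · rw [S.rep_monomial_neg, smul_zero]
      rw [S.range_smul, hzr]
      exact fun h => ht ⟨h.2.1.symm, h.2.2⟩
  set F := {t ∈ c.support | t.2.1 = t.2.2 • S.range x' ∧ E.IsPathFrom t.1 t.2.1} with hF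
  have hmem : ∀ t ∈ F, t.2.1 = t.2.2 • S.range x' ∧ E.IsPathFrom t.1 t.2.1 := fun t ht =>
    (Finset.mem_filter.1 ht).2
  -- On `F` the vertex is determined by the group element and can be dropped from the index.
  have hinjF : Set.InjOn (fun t : List Ed × V × G => (t.1, t.2.2)) F := by
    rintro ⟨l, v, g⟩ ht ⟨l', v', g'⟩ ht' h
    simp only [Prod.mk.injEq] at h
    have h1 := (hmem _ ht).1
    have h2 := (hmem _ ht').1
    simp only at h1 h2
    rw [h1, h2, h.1, h.2]
  have hsum : ∀ z, ∑ t ∈ F, Finsupp.single (S.app t.1 (t.2.2 • z)) (c t) =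
      ∑ i ∈ F.image (fun t => (t.1, t.2.2)),
        Finsupp.single (S.app i.1 (i.2 • z)) (c (i.1, i.2 • S.range x', i.2)) := by
    intro z
    rw [Finset.sum_image hinjF]
    refine Finset.sum_congr rfl fun t ht => ?_
    rw [← (hmem t ht).1]
  refine ⟨m, x', _, _, hx'C, ?_, fun z hz hzr => (key z hz hzr).trans (hsum z), ?_⟩
  · intro i hi
    obtain ⟨t, ht, rfl⟩ := Finset.mem_image.1 hi
    have := (hmem t ht).2
    rwa [(hmem t ht).1] at this
  · rw [← hsum, ← key x' hx'C rfl]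
    exact hrep

end BoundarySystem

/-! ### Infinite sequences of edges -/

namespace SelfSimilarAction

variable {G V Ed : Type*} [Group G] [MulAction G V] [MulAction G Ed]
  {E : RowFiniteGraph V Ed} (A : SelfSimilarAction G E)

/-- Infinite sequences of edges. -/
def EdgeSeq {G V Ed : Type*} [Group G] [MulAction G V] [MulAction G Ed]
    {E : RowFiniteGraph V Ed} (_A : SelfSimilarAction G E) : Type _ := ℕ → Ed

/-- The cocycle evaluated on the first `n` edges of a sequence. -/
def coc (g : G) (x : A.EdgeSeq) : ℕ → G
  | 0 => g
  | n + 1 => A.φ (coc g x n) (x n)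

/-- The self-similar action, not the pointwise one: the n-th edge is moved by what the cocycle has
made of g after n edges. -/
instance : SMul G A.EdgeSeq := ⟨fun g x n => A.coc g x n • x n⟩

variable {A}

theorem EdgeSeq.smul_apply (g : G) (x : A.EdgeSeq) (n : ℕ) : (g • x) n = A.coc g x n • x n := rfl

theorem coc_one (x : A.EdgeSeq) (n : ℕ) : A.coc 1 x n = 1 := by
  induction n with
  | zero => rfl
  | succ n ih => rw [coc, ih, A.φ_one]

theorem coc_mul (g h : G) (x : A.EdgeSeq) (n : ℕ) :
    A.coc (g * h) x n = A.coc g (h • x) n * A.coc h x n := by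
  induction n with
  | zero => rfl
  | succ n ih => rw [coc, ih, A.cocycle]; rfl

theorem coc_smul (g : G) (x : A.EdgeSeq) (n : ℕ) (v : V) : A.coc g x n • v = g • v := by
  induction n with
  | zero => rfl
  | succ n ih => rw [coc, A.φ_smul, ih]

instance : MulAction G A.EdgeSeq where
  one_smul x := funext fun n => by rw [EdgeSeq.smul_apply, coc_one, one_smul]
  mul_smul g h x := funext fun n => by
    rw [EdgeSeq.smul_apply, coc_mul, mul_smul]
    rfl

/-- Prepending an edge. -/
def EdgeSeq.cons (e : Ed) (x : A.EdgeSeq) : A.EdgeSeq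
  | 0 => e
  | n + 1 => x n

/-- Deleting the first edge. -/
def EdgeSeq.tail (x : A.EdgeSeq) : A.EdgeSeq := fun n => x (n + 1)

theorem coc_cons (g : G) (e : Ed) (x : A.EdgeSeq) (n : ℕ) :
    A.coc g (x.cons e) (n + 1) = A.coc (A.φ g e) x n := by
  induction n with
  | zero => rfl
  | succ n ih => rw [coc, ih]; rfl

theorem EdgeSeq.smul_cons (g : G) (e : Ed) (x : A.EdgeSeq) :
    g • x.cons e = (A.φ g e • x).cons (g • e) := by
  funext n
  cases n with
  | zero => rfl
  | succ n =>
    rw [EdgeSeq.smul_apply, coc_cons]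
    rfl

theorem EdgeSeq.cons_tail (x : A.EdgeSeq) : x.tail.cons (x 0) = x := by
  funext n
  cases n <;> rfl

variable (A)

/-- The system of infinite paths all of whose vertices lie in a `G`-invariant set `P` of vertices
which contains the range of an edge if it contains its source. -/
def pathSystem (P : Set V) (hG : ∀ (g : G), ∀ v ∈ P, g • v ∈ P)
    (hE : ∀ e, E.s e ∈ P → E.r e ∈ P) : BoundarySystem A A.EdgeSeq where
  head x := x 0
  tail x := x.tail
  cons e x := x.cons e
  head_cons _ _ := rfl
  tail_cons _ _ := rfl
  cons_head_tail x := x.cons_tail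
  smul_cons g e x := x.smul_cons g e
  carrier := {x | ∀ n, E.r (x (n + 1)) = E.s (x n) ∧ E.r (x n) ∈ P}
  smul_mem g x hx n := by
    simp only [EdgeSeq.smul_apply, A.range_smul, A.source_smul, coc_smul, (hx n).1, true_and]
    exact hG _ _ (hx n).2
  cons_mem e x hx h n := by
    cases n with
    | zero => exact ⟨h, hE e (h ▸ (hx 0).2)⟩
    | succ n => exact hx n
  tail_mem x hx n := hx (n + 1)
  range_tail x hx := (hx 0).1

/-- The system of infinite paths. -/
abbrev infinitePaths : BoundarySystem A A.EdgeSeq :=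
  A.pathSystem Set.univ (fun _ _ _ => trivial) (fun _ _ => trivial)

variable {A}

theorem mem_infinitePaths {x : A.EdgeSeq} :
    x ∈ A.infinitePaths.carrier ↔ ∀ n, E.r (x (n + 1)) = E.s (x n) :=
  ⟨fun h n => (h n).1, fun h n => ⟨h n, trivial⟩⟩

variable (A)

theorem exists_infinitePath {P : Set V} (hP : ∀ v ∈ P, ∃ e, E.r e = v ∧ E.s e ∈ P) {v : V}
    (hv : v ∈ P) : ∃ x ∈ A.infinitePaths.carrier, A.infinitePaths.range x = v ∧
      ∀ n, E.r (x n) ∈ P := by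
  have : Nonempty Ed := ⟨(hP v hv).choose⟩
  choose! e he using hP
  let w : ℕ → V := fun n => (fun u => E.s (e u))^[n] v
  have hw : ∀ n, w n ∈ P := by
    intro n
    induction n with
    | zero => exact hv
    | succ n ih =>
      change (fun u => E.s (e u))^[n + 1] v ∈ P
      rw [Function.iterate_succ_apply']
      exact (he _ ih).2
  refine ⟨fun n => e (w n), mem_infinitePaths.2 fun n => ?_, (he v hv).1, fun n => ?_⟩
  · rw [(he _ (hw _)).1]
    exact Function.iterate_succ_apply' _ _ _
  · rw [(he _ (hw _)).1]
    exact hw n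

theorem exists_infinitePath_range (v : V) :
    ∃ x ∈ A.infinitePaths.carrier, A.infinitePaths.range x = v := by
  obtain ⟨x, hx, hr, -⟩ := A.exists_infinitePath (P := Set.univ) (v := v)
    (fun v _ => (E.no_sources v).imp fun e he => ⟨he, trivial⟩) trivial
  exact ⟨x, hx, hr⟩

/-! ### Germs -/

/-- Infinite sequences of edges together with a germ at infinity of a sequence in `G` and a
degree. -/
@[ext]
structure GermSeq {G V Ed : Type*} [Group G] [MulAction G V] [MulAction G Ed]
    {E : RowFiniteGraph V Ed} (A : SelfSimilarAction G E) where
  seq : A.EdgeSeq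
  germ : Filter.Germ (Filter.atTop : Filter ℕ) G
  degree : ℤ

/-- The germ is multiplied by the sequence of cocycle values along the path. If g fixes such a
point, its cocycle there is eventually 1. The degree is left alone by the group and only counts
letters. -/
instance : SMul G A.GermSeq :=
  ⟨fun g x => ⟨g • x.seq, (A.coc g x.seq : Filter.Germ Filter.atTop G) * x.germ, x.degree⟩⟩

variable {A}

theorem GermSeq.germ_smul (g : G) (x : A.GermSeq) : (g • x).germ = A.coc g x.seq * x.germ := rfl

instance : MulAction G A.GermSeq where
  one_smul x := by
    refine GermSeq.ext (one_smul _ _) ?_ rfl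
    rw [GermSeq.germ_smul, show A.coc 1 x.seq = 1 from funext (coc_one x.seq)]
    exact one_mul _
  mul_smul g h x := by
    refine GermSeq.ext (mul_smul _ _ _) ?_ rfl
    rw [GermSeq.germ_smul, GermSeq.germ_smul, GermSeq.germ_smul,
      show A.coc (g * h) x.seq = A.coc g (h • x.seq) * A.coc h x.seq from
        funext (coc_mul g h x.seq), Filter.Germ.coe_mul, mul_assoc]
    rfl

variable (A)

/-- The system of infinite paths with germs. -/
noncomputable def germSystem : BoundarySystem A A.GermSeq where
  head x := x.seq 0
  tail x := ⟨x.seq.tail, x.germ.compTendsto (· + 1) (Filter.tendsto_add_atTop_nat 1),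
    x.degree - 1⟩
  -- Truncated subtraction at 0 is harmless, since only the germ at infinity is kept.
  cons e x := ⟨x.seq.cons e, x.germ.compTendsto (· - 1) (Filter.tendsto_sub_atTop_nat 1),
    x.degree + 1⟩
  head_cons _ _ := rfl
  tail_cons e x := by
    obtain ⟨x, c, d⟩ := x
    refine GermSeq.ext rfl ?_ (add_sub_cancel_right _ _)
    induction c using Filter.Germ.inductionOn with
    | _ c => rfl
  cons_head_tail x := by
    obtain ⟨x, c, d⟩ := x
    refine GermSeq.ext x.cons_tail ?_ (sub_add_cancel _ _)
    induction c using Filter.Germ.inductionOn with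
    | _ c =>
      refine Filter.Germ.coe_eq.2 ?_
      filter_upwards [Filter.eventually_ge_atTop 1] with n hn
      exact congrArg c (Nat.sub_add_cancel hn)
  smul_cons g e x := by
    obtain ⟨x, c, d⟩ := x
    refine GermSeq.ext (x.smul_cons g e) ?_ rfl
    induction c using Filter.Germ.inductionOn with
    | _ c =>
      refine Filter.Germ.coe_eq.2 ?_
      filter_upwards [Filter.eventually_ge_atTop 1] with n hn
      obtain ⟨n, rfl⟩ := Nat.exists_eq_add_of_le' hn
      exact congrArg (· * c n) (coc_cons g e x n)
  carrier := {x | x.seq ∈ A.infinitePaths.carrier}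
  smul_mem g x hx := A.infinitePaths.smul_mem g x.seq hx
  cons_mem e x hx h := A.infinitePaths.cons_mem e x.seq hx h
  tail_mem x hx := A.infinitePaths.tail_mem x.seq hx
  range_tail x hx := A.infinitePaths.range_tail x.seq hx

theorem germSystem_app_seq (l : List Ed) (x : A.GermSeq) :
    (A.germSystem.app l x).seq = A.infinitePaths.app l x.seq := by
  induction l with
  | nil => rfl
  | cons e l ih => exact congrArg (EdgeSeq.cons e) ih

theorem germSystem_app_degree (l : List Ed) (x : A.GermSeq) :
    (A.germSystem.app l x).degree = x.degree + l.length := by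
  induction l with
  | nil => exact (add_zero _).symm
  | cons e l ih =>
    change (A.germSystem.app l x).degree + 1 = _
    rw [ih, List.length_cons]
    push_cast
    ring

/-! ### Cylinders -/

/-- The infinite paths with range `v` that have the first `k` edges in common with `x`. -/
def cyl (v : V) (x : A.EdgeSeq) (k : ℕ) : Set A.EdgeSeq :=
  {z | z ∈ A.infinitePaths.carrier ∧ A.infinitePaths.range z = v ∧ ∀ n < k, z n = x n}

variable {A}

theorem mem_cyl_self {x : A.EdgeSeq} (hx : x ∈ A.infinitePaths.carrier) (k : ℕ) :
    x ∈ A.cyl (A.infinitePaths.range x) x k := ⟨hx, rfl, fun _ _ => rfl⟩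

theorem cyl_subset {v : V} {x y : A.EdgeSeq} {k m : ℕ} (hy : y ∈ A.cyl v x k) (h : k ≤ m) :
    A.cyl v y m ⊆ A.cyl v x k :=
  fun _ hz => ⟨hz.1, hz.2.1, fun n hn => (hz.2.2 n (hn.trans_le h)).trans (hy.2.2 n hn)⟩

theorem cyl_anti (v : V) (x : A.EdgeSeq) : Antitone (A.cyl v x) :=
  fun _ _ h _ hz => ⟨hz.1, hz.2.1, fun n hn => hz.2.2 n (hn.trans_le h)⟩

theorem coc_congr {x y : A.EdgeSeq} {k : ℕ} (h : ∀ n < k, x n = y n) (g : G) {n : ℕ} (hn : n ≤ k) :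
    A.coc g x n = A.coc g y n := by
  induction n with
  | zero => rfl
  | succ n ih => rw [coc, coc, ih (by omega), h n (by omega)]

theorem smul_congr_seq {x y : A.EdgeSeq} {k : ℕ} (h : ∀ n < k, x n = y n) (g : G) :
    ∀ n < k, (g • x) n = (g • y) n := fun n hn => by
  rw [EdgeSeq.smul_apply, EdgeSeq.smul_apply, coc_congr h g hn.le, h n hn]

theorem app_congr_seq {x y : A.EdgeSeq} {k : ℕ} (h : ∀ n < k, x n = y n) (l : List Ed) :
    ∀ n < l.length + k, A.infinitePaths.app l x n = A.infinitePaths.app l y n := by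
  induction l with
  | nil => simpa using h
  | cons e l ih =>
    rintro (_ | n) hn
    · rfl
    · exact ih n (by simp only [List.length_cons] at hn; omega)

theorem app_apply_add (l : List Ed) (x : A.EdgeSeq) (n : ℕ) :
    A.infinitePaths.app l x (l.length + n) = x n := by
  induction l with
  | nil => rw [List.length_nil, zero_add]; rfl
  | cons e l ih =>
    rw [List.length_cons, Nat.add_right_comm]
    exact ih

theorem app_smul_congr {x y : A.EdgeSeq} {k : ℕ} (h : ∀ n < k, x n = y n) (i : List Ed × G) :
    ∀ n < i.1.length + k,
      A.infinitePaths.app i.1 (i.2 • x) n = A.infinitePaths.app i.1 (i.2 • y) n :=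
  app_congr_seq (smul_congr_seq h i.2) i.1

theorem app_inj_of_length_eq {l l' : List Ed} (hl : l.length = l'.length) {x y : A.EdgeSeq}
    (h : A.infinitePaths.app l x = A.infinitePaths.app l' y) : l = l' ∧ x = y := by
  induction l generalizing l' with
  | nil =>
    obtain rfl := List.length_eq_zero_iff.1 hl.symm
    exact ⟨rfl, h⟩
  | cons e l ih =>
    obtain _ | ⟨e', l'⟩ := l'
    · simp at hl
    · obtain ⟨rfl, h'⟩ := A.infinitePaths.cons_inj h
      obtain ⟨rfl, h''⟩ := ih (by simpa using hl) h'
      exact ⟨rfl, h''⟩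

/-- Two maps `z ↦ l (g z)` with words of different lengths coincide in at most one point. -/
theorem eq_of_app_smul_eq {i j : List Ed × G} (hij : i.1.length < j.1.length) {x y : A.EdgeSeq}
    (hx : A.infinitePaths.app i.1 (i.2 • x) = A.infinitePaths.app j.1 (j.2 • x))
    (hy : A.infinitePaths.app i.1 (i.2 • y) = A.infinitePaths.app j.1 (j.2 • y)) : x = y := by
  suffices h : ∀ k, ∀ n < k, x n = y n from funext fun n => h (n + 1) n n.lt_succ_self
  intro k
  induction k with
  | zero => exact fun n hn => absurd hn n.not_lt_zero
  | succ k ih =>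
    -- Through the longer word `j.1`, agreement of x and y on k edges gives agreement of the images
    -- on `j.1.length + k` edges. Reading this through the shorter word gains at least one edge.
    have h1 : ∀ n < k + 1, (i.2 • x) n = (i.2 • y) n := fun n hn => by
      rw [← app_apply_add i.1 (i.2 • x), ← app_apply_add i.1 (i.2 • y), hx, hy]
      exact app_smul_congr ih j _ (by omega)
    simpa using smul_congr_seq h1 i.2⁻¹

end SelfSimilarAction

/-! ### Reduction of sums of maps -/

/-- Near a point, terms which coincide can be collected and zero terms can be dropped. -/
theorem exists_reduced_sum {ι Z Y R : Type*} [AddCommMonoid R] {B : ℕ → Set Z} (hB : Antitone B)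
    (f : ι → Z → Y) (F : Finset ι) (c : ι → R) :
    ∃ F' ⊆ F, ∃ (c' : ι → R) (K : ℕ),
      (∀ z ∈ B K, ∑ i ∈ F, Finsupp.single (f i z) (c i) =
        ∑ i ∈ F', Finsupp.single (f i z) (c' i)) ∧
      (∀ i ∈ F', c' i ≠ 0) ∧ ∀ i ∈ F', ∀ j ∈ F', i ≠ j → ∀ k, ∃ z ∈ B k, f i z ≠ f j z := by
  classical
  induction F using Finset.strongInduction generalizing c with
  | H F ih =>
    by_cases h0 : ∃ i ∈ F, c i = 0
    · obtain ⟨i, hi, hc⟩ := h0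
      obtain ⟨F', hF', c', K, h1, h2⟩ := ih (F.erase i) (Finset.erase_ssubset hi) c
      refine ⟨F', hF'.trans (Finset.erase_subset _ _), c', K, fun z hz => ?_, h2⟩
      rw [← h1 z hz, ← Finset.add_sum_erase F (fun i => Finsupp.single (f i z) (c i)) hi, hc,
        Finsupp.single_zero, zero_add]
    by_cases h1 : ∃ i ∈ F, ∃ j ∈ F, i ≠ j ∧ ∃ k, ∀ z ∈ B k, f i z = f j z
    · obtain ⟨i, hi, j, hj, hij, k, hk⟩ := h1
      obtain ⟨F', hF', c', K, h1, h2⟩ :=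
        -- The term j is absorbed into the coefficient of i.
        ih (F.erase j) (Finset.erase_ssubset hj) (Function.update c i (c i + c j))
      refine ⟨F', hF'.trans (Finset.erase_subset _ _), c', max K k, fun z hz => ?_, h2⟩
      have hi' : i ∈ F.erase j := Finset.mem_erase.2 ⟨hij, hi⟩
      have hs : ∑ l ∈ (F.erase j).erase i,
          Finsupp.single (f l z) (Function.update c i (c i + c j) l) =
          ∑ l ∈ (F.erase j).erase i, Finsupp.single (f l z) (c l) :=
        Finset.sum_congr rfl fun l hl => by
          rw [Function.update_of_ne (Finset.ne_of_mem_erase hl)]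
      rw [← h1 z (hB (le_max_left _ _) hz),
        ← Finset.add_sum_erase F (fun i => Finsupp.single (f i z) (c i)) hj,
        ← Finset.add_sum_erase (F.erase j) (fun i => Finsupp.single (f i z) (c i)) hi',
        ← Finset.add_sum_erase (F.erase j)
          (fun l => Finsupp.single (f l z) (Function.update c i (c i + c j) l)) hi', hs,
        Function.update_self, Finsupp.single_add, hk z (hB (le_max_right _ _) hz)]
      abel
    · push Not at h0 h1
      exact ⟨F, Finset.Subset.refl _, c, 0, fun _ _ => rfl, h0, h1⟩

namespace SelfSimilarAction

open ExelPardoAlgebra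

variable {G V Ed : Type*} [Group G] [MulAction G V] [MulAction G Ed]
  {E : RowFiniteGraph V Ed} {A : SelfSimilarAction G E}

/-! ### Strongly fixed paths -/

theorem actList_word (g : G) (n : ℕ) (x : A.EdgeSeq) :
    A.actList g (A.infinitePaths.word n x) = A.infinitePaths.word n (g • x) := by
  induction n generalizing g x with
  | zero => rfl
  | succ n ih =>
    rw [BoundarySystem.word, BoundarySystem.word, A.infinitePaths.tail_smul,
      A.infinitePaths.head_smul, ← ih]
    rfl

theorem cocycleList_word (g : G) (n : ℕ) (x : A.EdgeSeq) :
    A.cocycleList g (A.infinitePaths.word n x) = A.coc g x n := by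
  induction n generalizing g x with
  | zero => rfl
  | succ n ih =>
    conv_rhs => rw [← x.cons_tail, coc_cons]
    exact ih _ _

theorem word_prefix {n : ℕ} {x : A.EdgeSeq} {l : List Ed}
    (h : l <+: A.infinitePaths.word n x) : l = A.infinitePaths.word l.length x := by
  induction n generalizing x l with
  | zero =>
    obtain rfl := List.prefix_nil.1 h
    rfl
  | succ n ih =>
    obtain _ | ⟨e, l⟩ := l
    · rfl
    · obtain ⟨rfl, h'⟩ := List.cons_prefix_cons.1 h
      rw [List.length_cons, BoundarySystem.word, ← ih h']

/-- If `h` fixes `y` with eventually trivial cocycle, then the cocycle is trivial at a bounded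
stage. -/
theorem exists_bound_coc_eq_one
    (hfin : ∀ (g : G) (v : V), {α : E.Path | α.range = v ∧ A.MinimalStronglyFixed g α}.Finite)
    (h : G) (v : V) : ∃ K, ∀ y ∈ A.infinitePaths.carrier, A.infinitePaths.range y = v →
      h • y = y → (∃ n, A.coc h y n = 1) → ∃ n ≤ K, A.coc h y n = 1 := by
  classical
  -- K bounds the lengths of the minimal strongly fixed paths. Cutting y at the first stage where
  -- its cocycle is trivial gives such a path.
  obtain ⟨K, hK⟩ := ((hfin h v).image fun α => α.length).bddAbove
  refine ⟨K, fun y hy hv hfix hex => ⟨Nat.find hex, ?_, Nat.find_spec hex⟩⟩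
  set n := Nat.find hex
  let α : E.Path := ⟨v, A.infinitePaths.word n y, hv ▸ A.infinitePaths.isPathTo_word n hy⟩
  refine hK ⟨α, ⟨rfl, ⟨?_, ?_⟩, ?_⟩, A.infinitePaths.length_word n y⟩
  · refine RowFiniteGraph.Path.ext ?_ ?_
    · change h • v = v
      rw [← hv, ← A.infinitePaths.range_smul, hfix]
    · change A.actList h (A.infinitePaths.word n y) = A.infinitePaths.word n y
      rw [actList_word, hfix]
  · exact (cocycleList_word h n y).trans (Nat.find_spec hex)
  · rintro β ⟨hβr, hβ⟩ ⟨-, hβc⟩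
    have hβw := word_prefix hβ
    have hle : β.edges.length ≤ n := by
      simpa [α, A.infinitePaths.length_word] using hβ.length_le
    have hge : n ≤ β.edges.length := by
      refine Nat.find_min' hex ?_
      rw [← cocycleList_word, ← hβw]
      exact hβc
    refine RowFiniteGraph.Path.ext hβr ?_
    rw [hβw, le_antisymm hle hge]

/-! ### From a nonzero element to a vertex projection -/

variable {R : Type*} [CommRing R] [StarRing R]

/-- The vertex serves only to guarantee that an infinite path exists. -/
theorem infinitePaths_rep_injective [IsSimpleRing (ExelPardoAlgebra R A)] (v : V) :
    Function.Injective (A.infinitePaths.rep R) := by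
  obtain ⟨x, hx, -⟩ := A.exists_infinitePath_range v
  exact A.infinitePaths.rep_injective ⟨x, hx⟩

theorem range_app_word {y z : A.EdgeSeq} (hy : y ∈ A.infinitePaths.carrier) {k : ℕ}
    (hr : A.infinitePaths.range z = A.infinitePaths.range (A.infinitePaths.tail^[k] y)) :
    A.infinitePaths.range (A.infinitePaths.app (A.infinitePaths.word k y) z) =
      A.infinitePaths.range y := by
  rw [A.infinitePaths.range_app, hr, ← A.infinitePaths.sourceOf_word k hy]
  exact (E.isPathFrom_of_isPathTo (A.infinitePaths.isPathTo_word k hy)).2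

theorem app_word_mem_cyl {y z : A.EdgeSeq} (hy : y ∈ A.infinitePaths.carrier)
    (hz : z ∈ A.infinitePaths.carrier) {k : ℕ}
    (hr : A.infinitePaths.range z = A.infinitePaths.range (A.infinitePaths.tail^[k] y)) :
    A.infinitePaths.app (A.infinitePaths.word k y) z ∈ A.cyl (A.infinitePaths.range y) y k := by
  refine ⟨A.infinitePaths.app_mem hz (hr ▸ A.infinitePaths.isPathFrom_word k hy),
    range_app_word hy hr, fun n hn => ?_⟩
  have h := app_congr_seq (k := 0) (x := z) (y := A.infinitePaths.tail^[k] y)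
    (fun n hn => absurd hn n.not_lt_zero) (A.infinitePaths.word k y) n
    (by rw [A.infinitePaths.length_word]; exact hn)
  rwa [A.infinitePaths.app_word] at h

/-- In the simple case an element that fixes a cylinder pointwise has trivial cocycle eventually. -/
theorem exists_coc_eq_one (R : Type*) [CommRing R] [StarRing R]
    [IsSimpleRing (ExelPardoAlgebra R A)] {h : G} {y : A.EdgeSeq}
    (hy : y ∈ A.infinitePaths.carrier) {k : ℕ}
    (hfix : ∀ z ∈ A.cyl (A.infinitePaths.range y) y k, h • z = z) : ∃ n, A.coc h y n = 1 := by
  have := BoundarySystem.nontrivial_of_isSimpleRing (R := R) A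
  set w := A.infinitePaths.range (A.infinitePaths.tail^[k] y) with hw
  set l := A.infinitePaths.word k y with hl
  have hl' : E.IsPathFrom l w := A.infinitePaths.isPathFrom_word k hy
  -- The image of the monomial is the cylinder, which h fixes pointwise; faithfulness on plain paths
  -- gives the identity in the algebra.
  have key : p R A (A.infinitePaths.range y) h * monomial R A l w 1 = monomial R A l w 1 := by
    refine infinitePaths_rep_injective (A.infinitePaths.range y) (End.ext_single fun z => ?_)
    rw [map_mul, Module.End.mul_apply]
    by_cases hz : z ∈ A.infinitePaths.carrier ∧ A.infinitePaths.range z = w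
    · rw [BoundarySystem.rep_monomial_pos _ hz.1 (by rw [one_smul, hz.2]) hl', one_smul,
        BoundarySystem.rep_p_single]
      have hm := app_word_mem_cyl hy hz.1 hz.2
      rw [← hl] at hm
      rw [hfix _ hm, if_pos ⟨hm.1, hm.2.1⟩]
    · rw [BoundarySystem.rep_monomial_neg, map_zero]
      rw [one_smul]
      exact fun hz' => hz ⟨hz'.1, hz'.2.1⟩
  -- The same identity, evaluated on a point that carries a germ, forces the germ of the cocycle of
  -- h along y to be 1.
  let t : A.GermSeq := ⟨A.infinitePaths.tail^[k] y, 1, 0⟩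
  have ht : t ∈ A.germSystem.carrier := A.infinitePaths.iterate_tail_mem k hy
  have hseq : (A.germSystem.app l t).seq = y := by
    rw [germSystem_app_seq, hl]
    exact A.infinitePaths.app_word k y
  have h1 := congrArg (fun a => A.germSystem.rep R a (Finsupp.single t 1)) key
  have hmem : A.germSystem.app l t ∈ A.germSystem.carrier := by
    change (A.germSystem.app l t).seq ∈ A.infinitePaths.carrier
    rwa [hseq]
  have hrange : A.germSystem.range (h • A.germSystem.app l t) = A.infinitePaths.range y := by
    change A.infinitePaths.range (h • (A.germSystem.app l t).seq) = A.infinitePaths.range y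
    rw [hseq, hfix y (mem_cyl_self hy k)]
  simp only [map_mul, Module.End.mul_apply] at h1
  rw [BoundarySystem.rep_monomial_pos _ ht (by rw [one_smul]; rfl) hl', one_smul,
    BoundarySystem.rep_p_single, if_pos ⟨hmem, hrange⟩] at h1
  have h2 := congrArg GermSeq.germ (Finsupp.single_left_injective one_ne_zero h1)
  rw [GermSeq.germ_smul, mul_eq_right, hseq] at h2
  exact (Filter.Germ.coe_eq.1 h2).exists

/-- The cocycle at stage n depends only on the first n edges and stays 1 once it is 1, so edges
after that stage do not move. -/
theorem smul_eq_of_coc_eq_one {h : G} {y z : A.EdgeSeq} {n K : ℕ} (hy : h • y = y)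
    (hn : A.coc h y n = 1) (hnK : n ≤ K) (hz : ∀ m < K, z m = y m) : h • z = z := by
  have hzn : ∀ m, A.coc h z (n + m) = 1 := by
    intro m
    induction m with
    | zero => rw [add_zero, coc_congr hz h hnK, hn]
    | succ m ih => rw [← add_assoc, coc, ih, A.φ_one]
  funext m
  by_cases hm : m < n
  · rw [smul_congr_seq hz h m (hm.trans_le hnK), hy, hz m (hm.trans_le hnK)]
  · obtain ⟨m, rfl⟩ := Nat.exists_eq_add_of_le (not_lt.1 hm)
    rw [EdgeSeq.smul_apply, hzn, one_smul]

/-- If two maps `z ↦ l (g z)` do not coincide near `x`, then they do not coincide on any cylinder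
which is sufficiently close to `x`. -/
theorem exists_forall_cyl_ne (R : Type*) [CommRing R] [StarRing R]
    [IsSimpleRing (ExelPardoAlgebra R A)]
    (hfin : ∀ (g : G) (v : V), {α : E.Path | α.range = v ∧ A.MinimalStronglyFixed g α}.Finite)
    (v : V) (x : A.EdgeSeq) (i j : List Ed × G)
    (hx : ∀ k, ∃ z ∈ A.cyl v x k,
      A.infinitePaths.app i.1 (i.2 • z) ≠ A.infinitePaths.app j.1 (j.2 • z)) :
    ∃ K, ∀ y ∈ A.cyl v x K, ∀ k, ∃ z ∈ A.cyl v y k,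
      A.infinitePaths.app i.1 (i.2 • z) ≠ A.infinitePaths.app j.1 (j.2 • z) := by
  wlog hle : i.1.length ≤ j.1.length generalizing i j
  · simp only [ne_comm (a := A.infinitePaths.app i.1 _)] at hx ⊢
    exact this j i hx (le_of_not_ge hle)
  rcases hle.lt_or_eq with hlt | heq
  -- Otherwise there are points arbitrarily close to x around which the maps agree. Since they
  -- coincide in at most one point, these points are all the same and equal x, contrary to `hx`.
  · by_contra! hcon
    have hself : ∀ {K y k}, y ∈ A.cyl v x K → y ∈ A.cyl v y k :=
      fun hy => ⟨hy.1, hy.2.1, fun _ _ => rfl⟩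
    obtain ⟨y, hy, k, hk⟩ := hcon 0
    have hyx : y = x := by
      funext n
      obtain ⟨y', hy', k', hk'⟩ := hcon (n + 1)
      rw [eq_of_app_smul_eq hlt (hk y (hself hy)) (hk' y' (hself hy'))]
      exact hy'.2.2 n n.lt_succ_self
    obtain ⟨z, hz, hne⟩ := hx k
    rw [← hyx] at hz
    exact hne (hk z hz)
  -- If the maps agree around y, this quotient fixes a cylinder at y and has trivial cocycle by
  -- stage K. As y agrees with x that far, the quotient fixes the whole K-cylinder of x, contrary to
  -- `hx`.
  · obtain ⟨K, hK⟩ := exists_bound_coc_eq_one hfin (j.2⁻¹ * i.2) v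
    refine ⟨K, fun y hy k => ?_⟩
    by_contra! hcon
    have hfix : ∀ z ∈ A.cyl v y k, i.1 = j.1 ∧ (j.2⁻¹ * i.2) • z = z := fun z hz => by
      obtain ⟨h1, h2⟩ := app_inj_of_length_eq heq (hcon z hz)
      exact ⟨h1, by rw [mul_smul, h2, inv_smul_smul]⟩
    have hyy : y ∈ A.cyl v y k := ⟨hy.1, hy.2.1, fun _ _ => rfl⟩
    have hfix' : ∀ z ∈ A.cyl (A.infinitePaths.range y) y k, (j.2⁻¹ * i.2) • z = z := fun z hz =>
      (hfix z (hy.2.1 ▸ hz)).2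
    obtain ⟨n, hnK, hn⟩ := hK y hy.1 hy.2.1 (hfix y hyy).2 (exists_coc_eq_one R hy.1 hfix')
    obtain ⟨z, hz, hne⟩ := hx K
    refine hne ?_
    have hzfix := smul_eq_of_coc_eq_one (hfix y hyy).2 hn hnK
      (fun m hm => (hz.2.2 m hm).trans (hy.2.2 m hm).symm)
    rw [(hfix y hyy).1, ← inv_smul_eq_iff.1 ((mul_smul _ _ _).symm.trans hzfix)]

/-- Maps which do not coincide on any cylinder in an open set have disjoint images on some
cylinder. -/
theorem exists_cyl_disjoint {v : V} {x : A.EdgeSeq} {K : ℕ} (hx : x ∈ A.cyl v x K)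
    (P : Finset ((List Ed × G) × (List Ed × G)))
    (hP : ∀ q ∈ P, ∀ y ∈ A.cyl v x K, ∀ k, ∃ z ∈ A.cyl v y k,
      A.infinitePaths.app q.1.1 (q.1.2 • z) ≠ A.infinitePaths.app q.2.1 (q.2.2 • z)) :
    ∃ y k, y ∈ A.cyl v x K ∧ A.cyl v y k ⊆ A.cyl v x K ∧
      ∀ q ∈ P, ∀ z ∈ A.cyl v y k, ∀ z' ∈ A.cyl v y k,
        A.infinitePaths.app q.1.1 (q.1.2 • z) ≠ A.infinitePaths.app q.2.1 (q.2.2 • z') := by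
  classical
  induction P using Finset.induction_on with
  | empty => exact ⟨x, K, hx, subset_rfl, by simp⟩
  | insert q P _ ih =>
    obtain ⟨y, k, hy, hsub, hdisj⟩ := ih fun q hq => hP q (Finset.mem_insert_of_mem hq)
    obtain ⟨z, hz, hne⟩ := hP q (Finset.mem_insert_self _ _) y hy k
    obtain ⟨m, hm⟩ := Function.ne_iff.1 hne
    -- The two images of z differ at entry m, and the first m + 1 edges already determine that entry
    -- of both images.
    have hsub' := cyl_subset hz (le_max_left k (m + 1))
    refine ⟨z, max k (m + 1), hsub hz, hsub'.trans hsub, fun q' hq' => ?_⟩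
    rcases Finset.mem_insert.1 hq' with rfl | hq'
    · intro z₁ hz₁ z₂ hz₂ heq
      refine hm ?_
      rw [← app_smul_congr hz₁.2.2 q'.1 m (by omega), heq,
        app_smul_congr hz₂.2.2 q'.2 m (by omega)]
    · exact fun z₁ hz₁ z₂ hz₂ => hdisj q' hq' z₁ (hsub' hz₁) z₂ (hsub' hz₂)

/-- Every nonzero element of a simple algebra can be multiplied to a vertex projection. -/
theorem exists_mul_mul_eq_p [IsSimpleRing (ExelPardoAlgebra R A)]
    (hfin : ∀ (g : G) (v : V), {α : E.Path | α.range = v ∧ A.MinimalStronglyFixed g α}.Finite)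
    (v₀ : V) {a : ExelPardoAlgebra R A} (ha : a ≠ 0) : ∃ b d w, b * a * d = p R A w 1 := by
  classical
  have := BoundarySystem.nontrivial_of_isSimpleRing (R := R) A
  have hinj := infinitePaths_rep_injective (R := R) (A := A) v₀
  obtain ⟨m, x, F, c, hx, hF, ham, hne⟩ := A.infinitePaths.exists_local_form hinj ha
  set v := A.infinitePaths.range x with hv
  have hxx : ∀ k, x ∈ A.cyl v x k := mem_cyl_self hx
  obtain ⟨F', hF', c', K, hsum, hc', hagree⟩ :=
    exists_reduced_sum (cyl_anti v x) (fun i z => A.infinitePaths.app i.1 (i.2 • z)) F c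
  have hF'ne : F'.Nonempty := by
    rw [Finset.nonempty_iff_ne_empty]
    rintro rfl
    exact hne (by simpa using hsum x (hxx K))
  obtain ⟨i₀, hi₀⟩ := hF'ne
  choose! κ hκ using fun (q : (List Ed × G) × (List Ed × G)) (hq : q ∈ F'.offDiag) =>
    exists_forall_cyl_ne R hfin v x q.1 q.2
      (hagree q.1 (Finset.mem_offDiag.1 hq).1 q.2 (Finset.mem_offDiag.1 hq).2.1
        (Finset.mem_offDiag.1 hq).2.2)
  -- Deep enough for the reduced sum to be valid and for every pair of maps to disagree on all
  -- smaller cylinders.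
  obtain ⟨y, k, hy, hsub, hdisj⟩ := exists_cyl_disjoint (hxx (max K (F'.offDiag.sup κ)))
    F'.offDiag fun q hq y hy => hκ q hq y
      (cyl_anti v x ((Finset.le_sup hq).trans (le_max_right _ _)) hy)
  have hyr : A.infinitePaths.range y = v := hy.2.1
  set w := A.infinitePaths.range (A.infinitePaths.tail^[k] y) with hw
  set l := A.infinitePaths.word k y with hl
  have hlw : E.IsPathFrom l w := A.infinitePaths.isPathFrom_word k hy.1
  have hcyl : ∀ z ∈ A.infinitePaths.carrier, A.infinitePaths.range z = w →
      A.infinitePaths.app l z ∈ A.cyl v y k := fun z hz hzr =>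
    hyr ▸ app_word_mem_cyl hy.1 hz hzr
  set m' := monomial R A l w 1 with hm'
  set t := monomial R A i₀.1 (i₀.2 • v) i₀.2 with ht
  have hpath : E.IsPathFrom i₀.1 (i₀.2 • v) := hF i₀ (hF' hi₀)
  -- m' moves into the chosen cylinder, star t undoes the map of index i₀, and star m' leaves the
  -- cylinder again.
  have key : star m' * star t * a * (m * m') = c' i₀ • p R A w 1 := by
    refine hinj (End.ext_single fun z => ?_)
    rw [BoundarySystem.rep_smul, LinearMap.smul_apply, mul_assoc (_ * _), ← mul_assoc a]
    simp only [map_mul (A.infinitePaths.rep R) (_ * _), Module.End.mul_apply]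
    by_cases hz : z ∈ A.infinitePaths.carrier ∧ A.infinitePaths.range z = w
    swap
    · rw [hm', BoundarySystem.rep_monomial_neg, map_zero, map_zero,
        BoundarySystem.rep_p_one_single_neg _ hz, smul_zero]
      rw [one_smul]
      exact fun hz' => hz ⟨hz'.1, hz'.2.1⟩
    have hzc := hcyl z hz.1 hz.2
    have hm'z : A.infinitePaths.rep R m' (Finsupp.single z 1) =
        Finsupp.single (A.infinitePaths.app l z) 1 := by
      rw [hm', BoundarySystem.rep_monomial_pos _ hz.1 (by rw [one_smul, hz.2]) hlw, one_smul]
    have hm's : A.infinitePaths.rep R (star m')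
        (Finsupp.single (A.infinitePaths.app l z) 1) = Finsupp.single z 1 := by
      have h := BoundarySystem.rep_star_monomial_pos A.infinitePaths (R := R) (g := 1) hz.1
        (by rw [one_smul, hz.2]) hlw
      rwa [one_smul] at h
    rw [hm'z, ham _ hzc.1 hzc.2.1,
      hsum _ (cyl_anti v x (le_max_left _ _) (hsub hzc)), map_mul, Module.End.mul_apply, map_sum,
      map_sum, ← hz.2, BoundarySystem.rep_p_one_single_pos _ hz.1,
      Finset.sum_eq_single_of_mem i₀ hi₀]
    · rw [← mul_one (c' i₀), ← smul_eq_mul, ← Finsupp.smul_single, map_smul, map_smul, ht,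
        BoundarySystem.rep_star_monomial_pos _ hzc.1
          (by rw [BoundarySystem.range_smul, hzc.2.1]) hpath, hm's, smul_eq_mul, mul_one]
    · intro i hi hii
      rw [← mul_one (c' i), ← smul_eq_mul, ← Finsupp.smul_single, map_smul, map_smul]
      refine smul_eq_zero_of_right _ ?_
      -- Another term is killed by star t unless its value also lies in the image of the map of
      -- index i₀. Its preimage is then outside the cylinder, by disjointness, and star m' kills it.
      by_cases hex : ∃ y' ∈ A.infinitePaths.carrier, A.infinitePaths.range (i₀.2 • y') = i₀.2 • v ∧
          A.infinitePaths.app i₀.1 (i₀.2 • y') =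
            A.infinitePaths.app i.1 (i.2 • A.infinitePaths.app l z)
      · obtain ⟨y', hy', hr', heq⟩ := hex
        rw [← heq, ht, BoundarySystem.rep_star_monomial_pos _ hy' hr' hpath, hm',
          BoundarySystem.rep_star_monomial_neg]
        rintro z' hz' hzr' rfl
        rw [one_smul] at heq hzr'
        exact hdisj (i, i₀) (Finset.mem_offDiag.2 ⟨hi, hi₀, hii⟩) _ hzc _
          (hcyl z' hz' hzr') heq.symm
      · push Not at hex
        rw [ht, BoundarySystem.rep_star_monomial_neg _ hex, map_zero]
  have hne' : c' i₀ • p R A w 1 ≠ 0 := by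
    intro h0
    have h := congrArg (fun b => A.infinitePaths.rep R b
      (Finsupp.single (A.infinitePaths.tail^[k] y) 1)) h0
    simp only [BoundarySystem.rep_smul, LinearMap.smul_apply, map_zero,
      LinearMap.zero_apply] at h
    rw [hw, BoundarySystem.rep_p_one_single_pos _ (A.infinitePaths.iterate_tail_mem k hy.1),
      Finsupp.smul_single, smul_eq_mul, mul_one, Finsupp.single_eq_zero] at h
    exact hc' i₀ hi₀ h
  obtain ⟨d, hd⟩ := exists_smul_p_mul_eq hne'
  refine ⟨star m' * star t, m * m' * d, w, ?_⟩
  rw [← mul_assoc, key, hd]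

end SelfSimilarAction

/-! ### Infinite idempotents -/

section Idempotents

variable {B : Type*} [NonUnitalRing B]

/-- Infinite idempotents are transported along equivalences. -/
theorem IsInfiniteIdempotent.of_mul_eq {e x y : B} (he : IsInfiniteIdempotent e)
    (hy : y * e = y) (hxy : x * y = e) : IsInfiniteIdempotent (y * x) := by
  obtain ⟨-, f, h, hf, hh, hfh, hhf, hsum, ⟨a, b, ha, hb, hab, hba⟩, h0⟩ := he
  have hef : e * f = f := by rw [hsum, add_mul, hf, hhf, add_zero]
  have hfe : f * e = f := by rw [hsum, mul_add, hf, hfh, add_zero]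
  have heh : e * h = h := by rw [hsum, add_mul, hh, hfh, zero_add]
  have hhe : h * e = h := by rw [hsum, mul_add, hh, hhf, zero_add]
  have hee : e * e = e := by
    nth_rewrite 2 [hsum]
    rw [mul_add, hef, heh, ← hsum]
  -- Since x y = e, the map c ↦ y c x is multiplicative on the corner eBe; c ↦ x c y takes it back,
  -- which later shows that the complement is nonzero.
  have hmid : ∀ c d : B, y * c * x * (y * d * x) = y * (c * e * d) * x := fun c d => by
    rw [← hxy]; simp only [mul_assoc]
  have hea : e * a = a := by rw [← ha, mul_assoc, ← mul_assoc e, hee]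
  have haf : a * f = a := by rw [← ha, mul_assoc, hf]
  have hbe : b * e = b := by rw [← hb, mul_assoc, hee]
  have hfb : f * b = b := by rw [← hb, ← mul_assoc, ← mul_assoc, hf]
  have hae : a * e = a := by rw [← haf, mul_assoc, hfe]
  have hyx : y * x = y * e * x := by rw [hy]
  refine ⟨?_, y * f * x, y * h * x, ?_, ?_, ?_, ?_, ?_, ⟨y * a * x, y * b * x, ?_, ?_, ?_, ?_⟩, ?_⟩
  · rw [IsIdempotentElem, hyx, hmid, hee, hee]
  · rw [IsIdempotentElem, hmid, hfe, hf]
  · rw [IsIdempotentElem, hmid, hhe, hh]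
  · rw [hmid, hfe, hfh, mul_zero, zero_mul]
  · rw [hmid, hhe, hhf, mul_zero, zero_mul]
  · rw [← add_mul, ← mul_add, ← hsum, hy]
  · rw [hyx, hmid, hee, hea, hmid, hae, haf]
  · rw [hyx, hmid, hfe, hfb, hmid, hbe, hbe]
  · rw [hmid, hae, hab, hy]
  · rw [hmid, hbe, hba]
  · intro h1
    refine h0 ?_
    have h2 : x * (y * h * x) * y = e * h * e := by
      rw [← hxy]; simp only [mul_assoc]
    rw [heh, hhe, h1, mul_zero, zero_mul] at h2
    exact h2.symm

/-- A right ideal contains an infinite idempotent if one of its elements can be multiplied to an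
infinite idempotent. -/
theorem exists_isInfiniteIdempotent_mem {I : AddSubgroup B} (hI : ∀ x ∈ I, ∀ b : B, x * b ∈ I)
    {a e b d : B} (ha : a ∈ I) (he : IsInfiniteIdempotent e) (h : b * a * d = e) :
    ∃ f ∈ I, IsInfiniteIdempotent f := by
  have hee := he.1
  -- With y = a d e and x = e b one has x y = e, while y x begins with a.
  refine ⟨a * (d * e) * (e * b), hI _ (hI _ ha _) _, he.of_mul_eq ?_ ?_⟩
  · rw [mul_assoc, mul_assoc, hee]
  · calc e * b * (a * (d * e)) = e * (b * a * d) * e := by simp only [mul_assoc]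
      _ = e := by rw [h, hee, hee]

end Idempotents

namespace SelfSimilarAction

open ExelPardoAlgebra

variable {G V Ed : Type*} [Group G] [MulAction G V] [MulAction G Ed]
  {E : RowFiniteGraph V Ed} {A : SelfSimilarAction G E}

/-! ### Reachability of orbits -/

/-- There is a path with range `v` whose source lies in the orbit of `v'`. -/
def Reaches {G V Ed : Type*} [Group G] [MulAction G V] [MulAction G Ed]
    {E : RowFiniteGraph V Ed} (_A : SelfSimilarAction G E) (v v' : V) : Prop :=
  ∃ (l : List Ed) (h : G), E.IsPathTo v l ∧ E.sourceOf v l = h • v'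

theorem Reaches.refl (v : V) : A.Reaches v v := ⟨[], 1, trivial, (one_smul _ _).symm⟩

theorem Reaches.trans {v v' v'' : V} (h : A.Reaches v v') (h' : A.Reaches v' v'') :
    A.Reaches v v'' := by
  obtain ⟨l, g, hl, hs⟩ := h
  obtain ⟨l', g', hl', hs'⟩ := h'
  refine ⟨l ++ A.actList g l', g * g', E.isPathTo_append hl ?_, ?_⟩
  · rw [hs]
    exact A.isPathTo_actList l' g v' hl'
  · rw [E.sourceOf_append, hs, A.sourceOf_actList, hs', mul_smul]

theorem reaches_smul (g : G) (v : V) : A.Reaches (g • v) v := ⟨[], g, trivial, rfl⟩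

theorem reaches_source (e : Ed) : A.Reaches (E.r e) (E.s e) :=
  ⟨[e], 1, ⟨rfl, trivial⟩, (one_smul _ _).symm⟩

variable {R : Type*} [CommRing R] [StarRing R] [IsSimpleRing (ExelPardoAlgebra R A)]

variable (R) in
theorem p_ne_zero (w : V) : p R A w 1 ≠ 0 := by
  have := BoundarySystem.nontrivial_of_isSimpleRing (R := R) A
  intro h
  obtain ⟨x, hx, hr⟩ := A.exists_infinitePath_range w
  have h1 := A.infinitePaths.rep_p_one_single_pos (R := R) hx
  rw [hr, h, map_zero, LinearMap.zero_apply] at h1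
  exact Finsupp.single_ne_zero.2 one_ne_zero h1.symm

/-- Cofinality of simple algebras. -/
theorem exists_reaches (R : Type*) [CommRing R] [StarRing R]
    [IsSimpleRing (ExelPardoAlgebra R A)] (w : V) {x : A.EdgeSeq} (hx : x ∈ A.infinitePaths.carrier) :
    ∃ n, A.Reaches w (E.r (x n)) := by
  by_contra! hcon
  -- If x avoids all vertices reached from w, the paths that avoid them carry a faithful
  -- representation. But p_w vanishes there, because w reaches itself.
  let S := A.pathSystem {v | ¬ A.Reaches w v}
    (fun g v hv h => hv (h.trans (reaches_smul g v)))
    (fun e he h => he (h.trans (reaches_source e)))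
  have hxS : x ∈ S.carrier := fun n => ⟨mem_infinitePaths.1 hx n, hcon n⟩
  refine p_ne_zero R w (S.rep_injective ⟨x, hxS⟩ (End.ext_single fun z => ?_))
  rw [map_zero, LinearMap.zero_apply]
  refine S.rep_p_one_single_neg ?_
  rintro ⟨hz, hr⟩
  refine (hz 0).2 ?_
  change A.Reaches w (S.range z)
  rw [hr]
  exact Reaches.refl w

/-- A translate of the circuit starts at each vertex of the orbit of u and ends in that orbit. So
there is an infinite path all of whose vertices reach u, and cofinality applies to it. -/
theorem reaches_of_isGCircuit (R : Type*) [CommRing R] [StarRing R]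
    [IsSimpleRing (ExelPardoAlgebra R A)] {g : G} {γ : E.Path} (hγ : A.IsGCircuit g γ) (w : V) :
    A.Reaches w γ.range := by
  obtain ⟨u, l, hl⟩ := γ
  obtain ⟨hlen, hsrc⟩ := hγ
  obtain _ | ⟨e, l⟩ := l
  · exact absurd rfl hlen
  change E.sourceOf (E.s e) l = g • u at hsrc
  change A.Reaches w u
  obtain ⟨x, hx, -, hxu⟩ := A.exists_infinitePath (P := {v | A.Reaches v u}) (v := u) (by
    rintro v ⟨l', h, hl', hs⟩
    obtain _ | ⟨e', l'⟩ := l'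
    · change v = h • u at hs
      -- In the orbit of u, continue with the first edge of the translated circuit.
      refine ⟨h • e, by rw [A.range_smul, hl.1, hs], ?_⟩
      change A.Reaches (E.s (h • e)) u
      rw [A.source_smul]
      exact (reaches_smul h _).trans ⟨l, g, hl.2, hsrc⟩
    · exact ⟨e', hl'.1, l', h, hl'.2, hs⟩) (Reaches.refl (A := A) u)
  obtain ⟨n, hn⟩ := exists_reaches R w hx
  exact hn.trans (hxu n)

/-! ### Projections of circuits -/

theorem star_monomial_mul_monomial {l : List Ed} {g : G} {u : V} (hl : E.IsPathFrom l (g • u)) :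
    star (monomial R A l (g • u) g) * monomial R A l (g • u) g = p R A u 1 := by
  refine infinitePaths_rep_injective u (End.ext_single fun x => ?_)
  rw [map_mul, Module.End.mul_apply]
  by_cases hx : x ∈ A.infinitePaths.carrier ∧ A.infinitePaths.range x = u
  · have hr : A.infinitePaths.range (g • x) = g • u := by
      rw [BoundarySystem.range_smul, hx.2]
    rw [BoundarySystem.rep_monomial_pos _ hx.1 hr hl,
      BoundarySystem.rep_star_monomial_pos _ hx.1 hr hl, ← hx.2,
      BoundarySystem.rep_p_one_single_pos _ hx.1]
  · rw [BoundarySystem.rep_monomial_neg, map_zero, BoundarySystem.rep_p_one_single_neg _ hx]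
    rw [BoundarySystem.range_smul, smul_left_cancel_iff]
    exact fun h => hx ⟨h.1, h.2.1⟩

theorem monomial_mul_p {l : List Ed} {g : G} {u : V} :
    monomial R A l (g • u) g * p R A u 1 = monomial R A l (g • u) g := by
  refine infinitePaths_rep_injective u (End.ext_single fun x => ?_)
  rw [map_mul, Module.End.mul_apply]
  by_cases hx : x ∈ A.infinitePaths.carrier ∧ A.infinitePaths.range x = u
  · rw [← hx.2, BoundarySystem.rep_p_one_single_pos _ hx.1]
  · rw [BoundarySystem.rep_p_one_single_neg _ hx, map_zero, BoundarySystem.rep_monomial_neg]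
    rw [BoundarySystem.range_smul, smul_left_cancel_iff]
    exact fun h => hx ⟨h.1, h.2.1⟩

theorem p_mul_monomial_of_rangeOf {l : List Ed} {g : G} {v w : V} (hl : E.rangeOf l w = v) :
    p R A v 1 * monomial R A l w g = monomial R A l w g := by
  refine infinitePaths_rep_injective v (End.ext_single fun x => ?_)
  rw [map_mul, Module.End.mul_apply]
  by_cases hx : x ∈ A.infinitePaths.carrier ∧ A.infinitePaths.range (g • x) = w ∧
      E.IsPathFrom l w
  · obtain ⟨hx, rfl, hw⟩ := hx
    rw [BoundarySystem.rep_monomial_pos _ hx rfl hw, ← hl, ← BoundarySystem.range_app,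
      BoundarySystem.rep_p_one_single_pos]
    exact A.infinitePaths.app_mem (A.infinitePaths.smul_mem g x hx) hw
  · rw [BoundarySystem.rep_monomial_neg _ hx, map_zero]

/-- For the monomial t of the connecting path, t = p_w t and t*t = p_u, so t* p_w t = p_u. -/
theorem Reaches.exists_mul_p_mul_eq {w u : V} (h : A.Reaches w u) :
    ∃ b d, b * p R A w 1 * d = p R A u 1 := by
  obtain ⟨l, g, hl, hs⟩ := h
  obtain ⟨h1, h2⟩ := E.isPathFrom_of_isPathTo hl
  rw [hs] at h1 h2
  exact ⟨star (monomial R A l (g • u) g), monomial R A l (g • u) g, by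
    rw [mul_assoc, p_mul_monomial_of_rangeOf h2, star_monomial_mul_monomial h1]⟩

variable (R) in
/-- The range projection of a circuit at `u` is strictly smaller than `p_u`. -/
theorem monomial_mul_star_ne {l : List Ed} {g : G} {u : V} (hne : l ≠ [])
    (hl : E.IsPathFrom l (g • u)) (hr : E.rangeOf l (g • u) = u) :
    monomial R A l (g • u) g * star (monomial R A l (g • u) g) ≠ p R A u 1 := by
  have := BoundarySystem.nontrivial_of_isSimpleRing (R := R) A
  intro heq
  have hlen : 0 < l.length := List.length_pos_iff.2 hne
  -- Were the range projection all of p_u, every infinite path at u would be the image of another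
  -- one at u.
  have hsurj : ∀ y ∈ A.infinitePaths.carrier, A.infinitePaths.range y = u →
      ∃ x ∈ A.infinitePaths.carrier, A.infinitePaths.range x = u ∧
        A.infinitePaths.app l (g • x) = y := by
    intro y hy hyu
    by_contra! hcon
    have h1 := A.infinitePaths.rep_p_one_single_pos (R := R) hy
    rw [hyu, ← heq, map_mul, Module.End.mul_apply, BoundarySystem.rep_star_monomial_neg,
      map_zero] at h1
    · exact Finsupp.single_ne_zero.2 one_ne_zero h1.symm
    · intro x hx hxr
      rw [BoundarySystem.range_smul, smul_left_cancel_iff] at hxr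
      exact hcon x hx hxr
  -- Each passage to preimages gains `l.length` common edges, so there is only one infinite path at
  -- u.
  have hagree : ∀ k, ∀ y ∈ A.infinitePaths.carrier, A.infinitePaths.range y = u →
      ∀ y' ∈ A.infinitePaths.carrier, A.infinitePaths.range y' = u → ∀ n < k, y n = y' n := by
    intro k
    induction k with
    | zero => exact fun _ _ _ _ _ _ n hn => absurd hn n.not_lt_zero
    | succ k ih =>
      intro y hy hyu y' hy' hyu' n hn
      obtain ⟨x, hx, hxu, rfl⟩ := hsurj y hy hyu
      obtain ⟨x', hx', hxu', rfl⟩ := hsurj y' hy' hyu'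
      exact app_smul_congr (ih x hx hxu x' hx' hxu') (l, g) n (by simp only; omega)
  -- Both sides fix the unique path at u, hence are equal by faithfulness; but the monomial raises
  -- the degree by `l.length`, which is positive.
  have hone : monomial R A l (g • u) g = p R A u 1 := by
    refine infinitePaths_rep_injective u (End.ext_single fun x => ?_)
    by_cases hx : x ∈ A.infinitePaths.carrier ∧ A.infinitePaths.range x = u
    · have hgr : A.infinitePaths.range (g • x) = g • u := by
        rw [BoundarySystem.range_smul, hx.2]
      have hx' : A.infinitePaths.app l (g • x) = x := funext fun n =>
        hagree (n + 1) _ (A.infinitePaths.app_mem (A.infinitePaths.smul_mem g x hx.1)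
          (hgr ▸ hl)) (by rw [BoundarySystem.range_app, hgr, hr]) x hx.1 hx.2 n n.lt_succ_self
      rw [BoundarySystem.rep_monomial_pos _ hx.1 hgr hl, hx', ← hx.2,
        BoundarySystem.rep_p_one_single_pos _ hx.1]
    · rw [BoundarySystem.rep_monomial_neg, BoundarySystem.rep_p_one_single_neg _ hx]
      rw [BoundarySystem.range_smul, smul_left_cancel_iff]
      exact fun h => hx ⟨h.1, h.2.1⟩
  obtain ⟨x, hx, hxu⟩ := A.exists_infinitePath_range u
  let t : A.GermSeq := ⟨x, 1, 0⟩
  have ht : t ∈ A.germSystem.carrier := hx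
  have htu : A.germSystem.range t = u := hxu
  have h1 := A.germSystem.rep_p_one_single_pos (R := R) ht
  rw [htu, ← hone, BoundarySystem.rep_monomial_pos _ ht
    (by rw [BoundarySystem.range_smul, htu]) hl] at h1
  have h2 := congrArg GermSeq.degree (Finsupp.single_left_injective one_ne_zero h1)
  rw [germSystem_app_degree] at h2
  change (0 : ℤ) + l.length = 0 at h2
  omega

-- For the monomial z of the circuit, p_u is the sum of zz* and p_u − zz*. Here z* and z give the
-- equivalence of p_u with zz*, and the second summand is nonzero by `monomial_mul_star_ne`.
variable (R) in
theorem isInfiniteIdempotent_p_of_isGCircuit {g : G} {γ : E.Path} (hγ : A.IsGCircuit g γ) :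
    IsInfiniteIdempotent (p R A γ.range 1) := by
  obtain ⟨u, l, hl⟩ := γ
  obtain ⟨hlen, hsrc⟩ := hγ
  have hne : l ≠ [] := fun h => hlen (List.length_eq_zero_iff.2 h)
  change E.sourceOf u l = g • u at hsrc
  change IsInfiniteIdempotent (p R A u 1)
  obtain ⟨h1, h2⟩ := E.isPathFrom_of_isPathTo hl
  rw [hsrc] at h1 h2
  have hproper := monomial_mul_star_ne (A := A) R hne h1 h2
  have hzz := star_monomial_mul_monomial (R := R) (A := A) h1
  have hpz := p_mul_monomial_of_rangeOf (R := R) (A := A) (g := g) h2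
  have hzp := monomial_mul_p (R := R) (A := A) (l := l) (g := g) (u := u)
  have hpp := p_mul_p_one (R := R) (A := A) u
  have hps : star (p R A u 1) = p R A u 1 := (isGEFamily R A).eFamily.star_P u
  set z := monomial R A l (g • u) g
  set q := p R A u 1
  have hzsq : star z * q = star z := by rw [← hps, ← star_mul, hpz]
  have hqzs : q * star z = star z := by rw [← hps, ← star_mul, hzp]
  have hff : z * star z * (z * star z) = z * star z := by
    rw [mul_assoc, ← mul_assoc (star z), hzz, hqzs]
  have hqf : q * (z * star z) = z * star z := by rw [← mul_assoc, hpz]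
  have hfq : z * star z * q = z * star z := by rw [mul_assoc, hzsq]
  refine ⟨hpp, z * star z, q - z * star z, hff, ?_, ?_, ?_, (add_sub_cancel _ _).symm,
    ⟨star z, z, ?_, ?_, hzz, rfl⟩, sub_ne_zero.2 hproper.symm⟩
  · rw [IsIdempotentElem, sub_mul, mul_sub, mul_sub, hpp, hqf, hfq, hff, sub_self, sub_zero]
  · rw [mul_sub, hfq, hff, sub_self]
  · rw [sub_mul, hqf, hff, sub_self]
  · rw [hqzs, ← mul_assoc, hzz, hqzs]
  · rw [mul_assoc, hzp, mul_assoc, hzz, hzp]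

end SelfSimilarAction

theorem mainTheorem12 (R : Type*) [CommRing R] [StarRing R] {G V Ed : Type*} [Group G]
    [Countable G] [Countable V] [Countable Ed] [MulAction G V] [MulAction G Ed]
    (E : RowFiniteGraph V Ed) (A : SelfSimilarAction G E)
    (hfin : ∀ (g : G) (v : V), {α : E.Path | α.range = v ∧ A.MinimalStronglyFixed g α}.Finite)
    (hsimple : IsSimpleRing (ExelPardoAlgebra R A))
    (hcircuit : ∃ (g : G) (γ : E.Path), A.IsGCircuit g γ) :
    IsPurelyInfiniteSimple (ExelPardoAlgebra R A) := by
  obtain ⟨g, γ, hγ⟩ := hcircuit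
  refine ⟨hsimple, fun I hI hne => ?_⟩
  obtain ⟨a, haI, ha⟩ := I.bot_or_exists_ne_zero.resolve_left hne
  obtain ⟨b, d, w, h1⟩ := SelfSimilarAction.exists_mul_mul_eq_p hfin γ.range ha
  obtain ⟨b', d', h2⟩ := (SelfSimilarAction.reaches_of_isGCircuit R hγ w).exists_mul_p_mul_eq
    (R := R)
  -- Compressing a to p_w and then p_w to p_u exhibits the infinite idempotent p_u as a two-sided
  -- multiple of a.
  refine exists_isInfiniteIdempotent_mem hI haI (b := b' * b) (d := d * d')
    (SelfSimilarAction.isInfiniteIdempotent_p_of_isGCircuit R hγ) ?_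
  rw [← h2, ← h1]
  simp only [mul_assoc]
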